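/- All trees are finite, rooted and non-plane (considered up to isomorphism), and a tree is regarded as a poset whose maximum is the root ($x\le y$ iff $y$ lies on the path from the root to $x$). A binary tree is a tree in which every vertex has $0$ or $2$ children, and $\mathcal V_n$ is the set of all non-plane binary trees with $n$ vertices. For trees $S$ and $T$ let $a_T(S)$ be the number of embeddings of $S$ into $T$, i.e. of subposets of $T$ isomorphic to $S$, where two subposets that are mapped onto each other by an automorphism of $T$ are counted once, and let $a_{\mathcal V_n}(S)=\sum_{T\in\mathcal V_n}a_T(S)$. Let $V(z)=\sum_n|\mathcal V_n|z^n$ and $A_S(z)=\sum_n a_{\mathcal V_n}(S)z^n$. For a tree $S$, let $\mathcal M_S$ be the set of all unary-binary trees obtained from $S$ by replacing every vertex $v$ with $d\ge 3$ children, together with these children, by a non-plane binary tree with $d$ leaves whose root is $v$ and whose leaves are the children of $v$; its other $d-2$ internal vertices are called auxiliary, the vertices coming from $S$ are called original, and elements of $\mathcal M_S$ are taken up to isomorphisms that respect the distinction between original and auxiliary vertices. A symmetry node of $t\in\mathcal M_S$ is a vertex whose two children are the roots of isomorphic subtrees (again with the distinction respected), and $s(t)$ is the number of symmetry nodes of $t$.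 Put $$C_S=\sum_{t\in\mathcal M_S}\left(\tfrac12\right)^{s(t)}.$$ Theorem. The function $V$ satisfies $V(z)=z+\frac z2\left(V(z)^2+V(z^2)\right)$ for $|z|<\rho$, where $\rho\approx 0.6346$ (to the four digits given) is its radius of convergence. There is an $R>\rho$ such that $V$ and, for every tree $S$, the function $A_S$ are sums of their power series for $|z|<\rho$, continue analytically to the slit disc $$\Omega=\{z\in\mathbb C: |z|<R\}\setminus\left((-\infty,-\rho]\cup[\rho,\infty)\right),$$ and are singular at both $\rho$ and $-\rho$, so that $\pm\rho$ are the dominant singularities of $V$ and of $A_S$. If $S$ has $m$ vertices, $l$ leaves and $u$ vertices with exactly one child, then $$A_S(z)=\left(\frac1{1-zV(z)}\right)^{m+l-1}z^{l+u-1}\,V(z)^{l+u}\,C_S\,(1+o(1))$$ as $z\to\rho$ and as $z\to-\rho$ in $\Omega$. -/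

import Mathlib

open scoped Topology

/-- Finite rooted trees: a root together with finitely many subtrees. The list of subtrees is only
a way of writing the tree down: all notions below are formulated through the poset of vertices and
up to order isomorphism, so that the trees are considered as non-plane trees. -/
inductive FinRootedTree : Type
  | node (k : ℕ) (child : Fin k → FinRootedTree) : FinRootedTree

namespace FinRootedTree

/-- The vertices of a tree: the root `⊤` and the vertices of the subtrees of the root. -/
def Vertex : FinRootedTree → Type
  | node _ child => WithTop (Σ i, (child i).Vertex)

/-- The poset of vertices: `x ≤ y` iff `y` is on the path from the root to `x`. The vertices of
different subtrees of the root are incomparable, and the root is the maximum. -/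
instance instPartialOrderVertex : (T : FinRootedTree) → PartialOrder T.Vertex
  | node _ child =>
    letI := fun i => instPartialOrderVertex (child i)
    inferInstanceAs (PartialOrder (WithTop (Σ i, (child i).Vertex)))

/-- The root of a tree is the maximum of its poset of vertices. -/
instance instOrderTopVertex : (T : FinRootedTree) → OrderTop T.Vertex
  | node _ child => inferInstanceAs (OrderTop (WithTop (Σ i, (child i).Vertex)))

/-- The number of vertices. -/
noncomputable def size (T : FinRootedTree) : ℕ := Nat.card T.Vertex

/-- The out-degree (number of children) of an element of a poset. -/
noncomputable def outDegree {P : Type*} [PartialOrder P] (x : P) : ℕ :=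
  {y : P | y ⋖ x}.ncard

/-- The number of vertices of out-degree `i`. -/
noncomputable def degreeCount (T : FinRootedTree) (i : ℕ) : ℕ :=
  {x : T.Vertex | outDegree x = i}.ncard

/-- A binary tree: every vertex has `0` or `2` children. -/
def IsBinary (T : FinRootedTree) : Prop :=
  ∀ x : T.Vertex, outDegree x = 0 ∨ outDegree x = 2

/-- Isomorphism of the non-plane binary trees with `n` vertices. -/
instance binarySetoid (n : ℕ) : Setoid {T : FinRootedTree // T.IsBinary ∧ T.size = n} where
  r T T' := Nonempty (T.1.Vertex ≃o T'.1.Vertex)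
  iseqv :=
    ⟨fun _ => ⟨OrderIso.refl _⟩, fun ⟨e⟩ => ⟨e.symm⟩, fun ⟨e⟩ ⟨f⟩ => ⟨e.trans f⟩⟩

/-- The family `𝓥ₙ` of non-plane binary trees with `n` vertices. -/
def NonplaneBinary (n : ℕ) : Type := Quotient (binarySetoid n)

/-- A representative of a non-plane binary tree. -/
noncomputable def NonplaneBinary.tree {n : ℕ} (T : NonplaneBinary n) : FinRootedTree :=
  (Quotient.out T).1

/-- Two subposets of `T` isomorphic to `S` are the same embedding of `S` into the non-plane
tree `T` iff an automorphism of `T` maps one onto the other. -/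
instance embeddingSetoid (S T : FinRootedTree) :
    Setoid {E : Set T.Vertex // Nonempty (E ≃o S.Vertex)} where
  r E E' := ∃ φ : T.Vertex ≃o T.Vertex, φ '' E.1 = E'.1
  iseqv := by
    refine ⟨fun E => ⟨OrderIso.refl _, by simp⟩, ?_, ?_⟩
    · rintro E E' ⟨φ, h⟩
      exact ⟨φ.symm, by rw [← h, Set.image_image]; simp⟩
    · rintro E E' E'' ⟨φ, h⟩ ⟨ψ, h'⟩
      exact ⟨φ.trans ψ, by rw [← h', ← h, Set.image_image]; rfl⟩

/-- `a_T(S)`: the number of embeddings of `S` into the non-plane tree `T`. -/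
noncomputable def numEmbeddings (S T : FinRootedTree) : ℕ :=
  Nat.card (Quotient (embeddingSetoid S T))

/-- `a_{𝓥ₙ}(S)`: the number of embeddings of `S` into all non-plane binary trees with `n`
vertices. -/
noncomputable def totalEmbeddings (S : FinRootedTree) (n : ℕ) : ℕ :=
  ∑ᶠ T : NonplaneBinary n, numEmbeddings S T.tree

/-- A tree with a distinguished set of vertices, the *original* vertices; the other vertices are
called *auxiliary*. -/
structure MarkedTree where
  /-- the underlying tree -/
  tree : FinRootedTree
  /-- the set of original vertices -/
  original : Set tree.Vertex

/-- `t` arises from `S` by replacing each vertex `v` with `d ≥ 3` children, together with these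
children, by a binary tree with `d` leaves: the root of that binary tree is `v`, its leaves are the
children of `v`, and its `d - 2` other internal vertices are auxiliary. In terms of posets: the
original vertices form a copy of `S` and include the root of `t`, auxiliary vertices have two
children, and an original vertex with `d` children in `S` has `min 2 d` children in `t`. -/
def IsBinarization (S : FinRootedTree) (t : MarkedTree) : Prop :=
  ⊤ ∈ t.original ∧
  Nonempty (t.original ≃o S.Vertex) ∧
  (∀ x : t.tree.Vertex, x ∉ t.original → outDegree x = 2) ∧
  ∀ x : t.original, outDegree (x : t.tree.Vertex) = min 2 (outDegree x)

/-- Isomorphism of the binarizations of `S`; isomorphisms send original vertices to original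
vertices and auxiliary vertices to auxiliary vertices. -/
instance binarizationSetoid (S : FinRootedTree) : Setoid {t : MarkedTree // S.IsBinarization t} where
  r t t' := ∃ φ : t.1.tree.Vertex ≃o t'.1.tree.Vertex, φ '' t.1.original = t'.1.original
  iseqv := by
    refine ⟨fun t => ⟨OrderIso.refl _, by simp⟩, ?_, ?_⟩
    · rintro t t' ⟨φ, h⟩
      exact ⟨φ.symm, by rw [← h, Set.image_image]; simp⟩
    · rintro t t' t'' ⟨φ, h⟩ ⟨ψ, h'⟩
      exact ⟨φ.trans ψ, by rw [← h', ← h, Set.image_image]; rfl⟩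

/-- The set `𝓜_S` of non-plane unary-binary trees obtained from `S`. -/
def Binarization (S : FinRootedTree) : Type := Quotient (binarizationSetoid S)

/-- The number of symmetry nodes of `t`, i.e. of vertices with two children that are the roots of
isomorphic subtrees (where isomorphisms respect the distinction of original and auxiliary
vertices). -/
noncomputable def MarkedTree.numSymmetryNodes (t : MarkedTree) : ℕ :=
  {x : t.tree.Vertex | ∃ y y' : t.tree.Vertex, y ⋖ x ∧ y' ⋖ x ∧ y ≠ y' ∧
    ∃ φ : Set.Iic y ≃o Set.Iic y',
      ∀ a : Set.Iic y, (φ a : t.tree.Vertex) ∈ t.original ↔ (a : t.tree.Vertex) ∈ t.original}.ncard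

/-- The constant `C_S`: the sum of `(1/2) ^ s` over the trees of `𝓜_S`, with `s` the number of
symmetry nodes. -/
noncomputable def symmetryConstant (S : FinRootedTree) : ℝ :=
  ∑ᶠ t : S.Binarization, (1 / 2 : ℝ) ^ (Quotient.out t).1.numSymmetryNodes

end FinRootedTree

/-- The open disc of radius `R` around `0` without the two real half-lines `[ρ, ∞)` and
`(-∞, -ρ]`. -/
def slitDisc (ρ R : ℝ) : Set ℂ := {z | ‖z‖ < R ∧ ¬ (z.im = 0 ∧ ρ ≤ |z.re|)}

/-- `F` is the generating function of the sequence `c`, and `ρ` and `-ρ` are its dominant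
singularities: `F` is the sum of `∑ cₙ zⁿ` for `‖z‖ < ρ`, continued analytically to a disc of
radius `R > ρ` with the two slits from `±ρ` outwards, and at none of the two points `±ρ` it
coincides with a function that is analytic there. -/
def HasDominantSingularities (c : ℕ → ℕ) (F : ℂ → ℂ) (ρ R : ℝ) : Prop :=
  0 < ρ ∧ ρ < R ∧
  (∀ z : ℂ, ‖z‖ < ρ → HasSum (fun n => (c n : ℂ) * z ^ n) (F z)) ∧
  DifferentiableOn ℂ F (slitDisc ρ R) ∧
  (¬ ∃ g : ℂ → ℂ, AnalyticAt ℂ g (ρ : ℂ) ∧ F =ᶠ[𝓝[slitDisc ρ R] (ρ : ℂ)] g) ∧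
  (¬ ∃ g : ℂ → ℂ, AnalyticAt ℂ g (-ρ : ℂ) ∧ F =ᶠ[𝓝[slitDisc ρ R] (-ρ : ℂ)] g)

/-!
An embedding of `S` into a binary tree is a marking of vertices, so `A_S` is the generating function
of the isomorphism classes of marked binary trees whose marked vertices form the poset `S`. Looking
at the root, and allowing forests in place of `S`, one expresses `A_S` times `1 - z * V z` through
the functions `A_G` of smaller posets: every forest is split into two nonempty parts, one for each
of the two branches, up to exchange. The diagonal terms of the exchange contain `A_G (z ^ 2)` and
are analytic beyond the radius of convergence. Hence `A_S` is continued by rational operations from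
`V`, its leading singular term is a negative power of `1 - z * V z`, and the leading coefficient
obeys the recursion that the sum over binarizations weighted by `(1 / 2) ^ s` satisfies.

The functional equation of `V` reads `(1 - z * V z) ^ 2 = 1 - 2 * z ^ 2 - z ^ 2 * V (z ^ 2)`. The
right-hand side is an even function, analytic for `‖z‖ ^ 2 < ρ`, whose only zeros of modulus at
most `ρ` are simple ones at `±ρ`, and it takes no values in `(-∞, 0]` on a slit disc of radius
slightly more than `ρ`. Its principal square root therefore continues `1 - z * V z` to that slit
disc and has branch points at `±ρ`, where `1 - z * V z` tends to `0`.
-/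

namespace FinRootedTree

open Filter

/-! ### Initial segments and counting -/

section InitialSeg

variable {P Q : Type*} [PartialOrder P] [PartialOrder Q]

theorem covBy_initialSeg_iff (f : P ≤i Q) {x : P} {y : Q} :
    y ⋖ f x ↔ ∃ z, z ⋖ x ∧ f z = y := by
  constructor
  · intro h
    obtain ⟨z, -, rfl⟩ := f.lt_apply_iff.1 h.lt
    exact ⟨z, f.apply_covBy_apply_iff.1 h, rfl⟩
  · rintro ⟨z, h, rfl⟩
    exact f.apply_covBy_apply_iff.2 h

theorem outDegree_initialSeg (f : P ≤i Q) (x : P) : outDegree (f x) = outDegree x := by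
  have hcov : {y | y ⋖ f x} = f '' {y | y ⋖ x} := Set.ext fun _ => covBy_initialSeg_iff f
  rw [outDegree, hcov, Set.ncard_image_of_injective _ (EmbeddingLike.injective f), outDegree]

theorem outDegree_orderIso (e : P ≃o Q) (x : P) : outDegree (e x) = outDegree x :=
  outDegree_initialSeg e.toInitialSeg x

theorem outDegree_eq_zero_iff [Finite P] {x : P} : outDegree x = 0 ↔ IsMin x := by
  rw [outDegree, Set.ncard_eq_zero (Set.toFinite _), Set.eq_empty_iff_forall_notMem]
  constructor
  · intro h y hy
    by_contra hne
    obtain ⟨z, -, hz⟩ := exists_le_covBy_of_lt (lt_of_le_not_ge hy hne)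
    exact h z hz
  · exact fun h y hy => h.not_lt (CovBy.lt hy)

/-- The inclusion of the left summand of a disjoint union of posets as an initial segment. -/
def inlInitialSeg : P ≤i P ⊕ Q where
  toFun := Sum.inl
  inj' := Sum.inl_injective
  map_rel_iff' := Sum.inl_lt_inl_iff
  mem_range_of_rel' := by
    rintro a (b | b) h
    · exact ⟨b, rfl⟩
    · exact absurd h Sum.not_inr_lt_inl

/-- The inclusion of the right summand of a disjoint union of posets as an initial segment. -/
def inrInitialSeg : Q ≤i P ⊕ Q where
  toFun := Sum.inr
  inj' := Sum.inr_injective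
  map_rel_iff' := Sum.inr_lt_inr_iff
  mem_range_of_rel' := by
    rintro a (b | b) h
    · exact absurd h Sum.not_inl_lt_inr
    · exact ⟨b, rfl⟩

/-- The inclusion of a poset as an initial segment of the poset with a maximum adjoined. -/
def withTopInitialSeg : P ≤i WithTop P where
  toFun := WithTop.some
  inj' := WithTop.coe_injective
  map_rel_iff' := WithTop.coe_lt_coe
  mem_range_of_rel' := by
    intro a b h
    obtain ⟨x, rfl, -⟩ := WithTop.lt_iff_exists_coe.1 h
    exact ⟨x, rfl⟩

/-- The inclusion of a summand of a disjoint union of posets as an initial segment. -/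
def sigmaInitialSeg {ι : Type*} {P : ι → Type*} [∀ i, PartialOrder (P i)] (i : ι) :
    P i ≤i Σ i, P i where
  toFun := Sigma.mk i
  inj' := sigma_mk_injective
  map_rel_iff' := Sigma.mk_lt_mk_iff
  mem_range_of_rel' := by
    rintro a ⟨j, b⟩ h
    obtain ⟨hji, -⟩ := Sigma.lt_def.1 h
    obtain rfl : j = i := hji
    exact ⟨b, rfl⟩

/-- The restriction of an initial segment embedding to subsets that correspond to each other. -/
def restrictInitialSeg (f : P ≤i Q) {E : Set P} {E' : Set Q} (h : ∀ x, f x ∈ E' ↔ x ∈ E) :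
    E ≤i E' where
  toFun x := ⟨f x, (h x).2 x.2⟩
  inj' _ _ hxy := Subtype.ext (f.inj.1 (congrArg Subtype.val hxy))
  map_rel_iff' := f.lt_iff_lt
  mem_range_of_rel' := by
    rintro a ⟨b, hb⟩ hba
    obtain ⟨c, -, rfl⟩ := f.lt_apply_iff.1 (show b < f a from hba)
    exact ⟨⟨c, (h c).1 hb⟩, rfl⟩

theorem outDegree_restrict (f : P ≤i Q) {E : Set P} {E' : Set Q} (h : ∀ x, f x ∈ E' ↔ x ∈ E)
    (x : P) (hx : x ∈ E) :
    outDegree (⟨f x, (h x).2 hx⟩ : E') = outDegree (⟨x, hx⟩ : E) :=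
  outDegree_initialSeg (restrictInitialSeg f h) ⟨x, hx⟩

end InitialSeg

section Counting

theorem ncard_setOf_congr {X Y : Type*} (e : X ≃ Y) {p : X → Prop} {q : Y → Prop}
    (h : ∀ x, p x ↔ q (e x)) : {x | p x}.ncard = {y | q y}.ncard :=
  Nat.card_congr (e.subtypeEquiv h)

open scoped Classical in
theorem ncard_setOf_eq_sum {X : Type*} [Fintype X] (p : X → Prop) :
    {x | p x}.ncard = ∑ x, if p x then 1 else 0 := by
  rw [Set.ncard_eq_toFinset_card', Finset.sum_boole, Set.toFinset_ofPred, Nat.cast_id]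

theorem ncard_setOf_sum {X Y : Type*} [Finite X] [Finite Y] (p : X ⊕ Y → Prop) :
    {x | p x}.ncard = {x | p (.inl x)}.ncard + {y | p (.inr y)}.ncard := by
  have := Fintype.ofFinite X
  have := Fintype.ofFinite Y
  simp only [ncard_setOf_eq_sum, Fintype.sum_sum_type]

open scoped Classical in
theorem ncard_setOf_withTop {X : Type*} [Finite X] (p : WithTop X → Prop) :
    {x | p x}.ncard = (if p ⊤ then 1 else 0) + {x : X | p x}.ncard := by
  have := Fintype.ofFinite X
  let : Fintype (WithTop X) := inferInstanceAs (Fintype (Option X))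
  rw [ncard_setOf_eq_sum, ncard_setOf_eq_sum]
  exact Fintype.sum_option (α := X) fun x => if p x then 1 else 0

theorem ncard_setOf_sigma {ι : Type*} {X : ι → Type*} [Fintype ι] [∀ i, Finite (X i)]
    (p : (Σ i, X i) → Prop) : {x | p x}.ncard = ∑ i, {x | p ⟨i, x⟩}.ncard := by
  have := fun i => Fintype.ofFinite (X i)
  simp only [ncard_setOf_eq_sum, Fintype.sum_sigma]

end Counting

section MaxCount

variable {P Q : Type*} [PartialOrder P] [PartialOrder Q]

/-- The number of maximal elements of a poset, i.e. of trees in a forest. -/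
noncomputable def maxCount (P : Type*) [PartialOrder P] : ℕ := {x : P | IsMax x}.ncard

/-- The number of elements of a poset that cover nothing, i.e. of leaves of a forest. -/
noncomputable def leafCount (P : Type*) [PartialOrder P] : ℕ := {x : P | outDegree x = 0}.ncard

theorem maxCount_congr (e : P ≃o Q) : maxCount P = maxCount Q :=
  ncard_setOf_congr e.toEquiv fun _ => e.isMax_apply.symm

theorem leafCount_congr (e : P ≃o Q) : leafCount P = leafCount Q :=
  ncard_setOf_congr e.toEquiv fun x => by rw [← outDegree_orderIso e x]; rfl

theorem maxCount_of_isEmpty [IsEmpty P] : maxCount P = 0 := by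
  rw [maxCount, Set.eq_empty_of_isEmpty {x : P | _}, Set.ncard_empty]

theorem leafCount_of_isEmpty [IsEmpty P] : leafCount P = 0 := by
  rw [leafCount, Set.eq_empty_of_isEmpty {x : P | _}, Set.ncard_empty]

theorem maxCount_pos [Finite P] [Nonempty P] : 0 < maxCount P := by
  rw [maxCount, Set.ncard_pos]
  obtain ⟨x, hx⟩ := Set.finite_univ.exists_maximal (Set.univ_nonempty (α := P))
  exact ⟨x, fun y hy => hx.2 trivial hy⟩

theorem leafCount_pos [Finite P] [Nonempty P] : 0 < leafCount P := by
  rw [leafCount, Set.ncard_pos]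
  obtain ⟨x, hx⟩ := Set.finite_univ.exists_minimal (Set.univ_nonempty (α := P))
  exact ⟨x, outDegree_eq_zero_iff.2 fun y hy => hx.2 trivial hy⟩

theorem maxCount_sum [Finite P] [Finite Q] : maxCount (P ⊕ Q) = maxCount P + maxCount Q := by
  have hinl (x : P) : IsMax (Sum.inl x : P ⊕ Q) ↔ IsMax x := by simp [IsMax]
  have hinr (x : Q) : IsMax (Sum.inr x : P ⊕ Q) ↔ IsMax x := by simp [IsMax]
  simp only [maxCount, ncard_setOf_sum, hinl, hinr]

theorem leafCount_sum [Finite P] [Finite Q] : leafCount (P ⊕ Q) = leafCount P + leafCount Q := by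
  have hinl (x : P) : outDegree (Sum.inl x : P ⊕ Q) = outDegree x :=
    outDegree_initialSeg (inlInitialSeg : P ≤i P ⊕ Q) x
  have hinr (x : Q) : outDegree (Sum.inr x : P ⊕ Q) = outDegree x :=
    outDegree_initialSeg (inrInitialSeg : Q ≤i P ⊕ Q) x
  simp only [leafCount, ncard_setOf_sum, hinl, hinr]

theorem maxCount_withTop : maxCount (WithTop P) = 1 := by
  rw [maxCount, Set.ncard_eq_one]
  exact ⟨⊤, by ext x; simp⟩

theorem outDegree_top_withTop : outDegree (⊤ : WithTop P) = maxCount P := by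
  have hcov : {y : WithTop P | y ⋖ ⊤} = WithTop.some '' {x : P | IsMax x} := by
    ext y
    simp only [Set.mem_ofPred_eq, WithTop.covBy_top_iff, Set.mem_image]
    exact exists_congr fun a => and_congr_right fun _ => eq_comm
  rw [outDegree, hcov, Set.ncard_image_of_injective _ WithTop.coe_injective, maxCount]

open scoped Classical in
theorem leafCount_withTop [Finite P] :
    leafCount (WithTop P) = (if maxCount P = 0 then 1 else 0) + leafCount P := by
  have hcoe (x : P) : outDegree (x : WithTop P) = outDegree x :=
    outDegree_initialSeg withTopInitialSeg x
  simp only [leafCount, ncard_setOf_withTop, outDegree_top_withTop, hcoe]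

theorem apply_coe_ne_top (e : WithTop P ≃o WithTop Q) (x : P) : e x ≠ ⊤ :=
  fun h => WithTop.coe_ne_top (e.injective (h.trans e.map_top.symm))

/-- An isomorphism of posets with adjoined maxima, restricted to the posets themselves. -/
def orderIsoOfWithTop (e : WithTop P ≃o WithTop Q) : P ≃o Q where
  toFun x := (e x).untop (apply_coe_ne_top e x)
  invFun y := (e.symm y).untop (apply_coe_ne_top e.symm y)
  left_inv x := by simp
  right_inv y := by simp
  map_rel_iff' := by simp

theorem coe_orderIsoOfWithTop (e : WithTop P ≃o WithTop Q) (x : P) :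
    (orderIsoOfWithTop e x : WithTop Q) = e x :=
  WithTop.coe_untop _ _

end MaxCount

/-! ### Isomorphism classes of finite posets -/

section Sigma

variable {ι κ : Type*} {P : ι → Type*} {Q : κ → Type*}

theorem sigma_map_le_iff [∀ i, LE (P i)] [∀ j, LE (Q j)] {f : ι → κ}
    (hf : Function.Injective f) {g : ∀ i, P i → Q (f i)}
    (hg : ∀ i x y, g i x ≤ g i y ↔ x ≤ y) {a b : Σ i, P i} :
    Sigma.map f g a ≤ Sigma.map f g b ↔ a ≤ b := by
  obtain ⟨i, x⟩ := a
  obtain ⟨j, y⟩ := b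
  by_cases hij : i = j
  · subst hij
    exact (Sigma.mk_le_mk_iff (a := g i x) (b := g i y)).trans ((hg i x y).trans
      Sigma.mk_le_mk_iff.symm)
  · exact iff_of_false (fun h => hij (hf (Sigma.le_def.1 h).1)) fun h => hij (Sigma.le_def.1 h).1

variable [∀ i, PartialOrder (P i)] [∀ j, PartialOrder (Q j)]

/-- The isomorphism of disjoint unions given by a bijection of the index sets and isomorphisms of
the summands. -/
def sigmaCongrOrderIso (σ : ι ≃ κ) (ψ : ∀ i, P i ≃o Q (σ i)) : (Σ i, P i) ≃o Σ j, Q j where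
  toEquiv := σ.sigmaCongr fun i => (ψ i).toEquiv
  map_rel_iff' := sigma_map_le_iff σ.injective fun i _ _ => (ψ i).le_iff_le

/-- A disjoint union over `Fin (k + 1)` with its first summand split off. -/
noncomputable def sumSigmaFinOrderIso {k : ℕ} (P : Fin (k + 1) → Type*)
    [∀ i, PartialOrder (P i)] : P 0 ⊕ (Σ i : Fin k, P i.succ) ≃o Σ i, P i :=
  RelIso.ofSurjective
    (OrderEmbedding.ofMapLEIff
      (Sum.elim (Sigma.mk 0) (Sigma.map Fin.succ fun _ => id) :
        P 0 ⊕ (Σ i : Fin k, P i.succ) → Σ i, P i) fun a b => by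
      rcases a with x | ⟨i, x⟩ <;> rcases b with y | ⟨j, y⟩
      · exact Sigma.mk_le_mk_iff.trans Sum.inl_le_inl_iff.symm
      · exact iff_of_false (fun h => Fin.succ_ne_zero j (Sigma.le_def.1 h).1.symm)
          Sum.not_inl_le_inr
      · exact iff_of_false (fun h => Fin.succ_ne_zero i (Sigma.le_def.1 h).1) Sum.not_inr_le_inl
      · exact (sigma_map_le_iff (Fin.succ_injective k) fun _ _ _ => Iff.rfl).trans
          Sum.inr_le_inr_iff.symm) <| by
    rintro ⟨i, x⟩
    induction i using Fin.cases with
    | zero => exact ⟨.inl x, rfl⟩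
    | succ i => exact ⟨.inr ⟨i, x⟩, rfl⟩

end Sigma

/-- A finite poset. -/
structure FinPoset : Type 1 where
  carrier : Type
  [order : PartialOrder carrier]
  [finite : Finite carrier]

attribute [instance] FinPoset.order FinPoset.finite

instance FinPoset.isoSetoid : Setoid FinPoset where
  r P Q := Nonempty (P.carrier ≃o Q.carrier)
  iseqv := ⟨fun _ => ⟨OrderIso.refl _⟩, fun ⟨e⟩ => ⟨e.symm⟩, fun ⟨e⟩ ⟨f⟩ => ⟨e.trans f⟩⟩

/-- Isomorphism classes of finite posets. The disjoint union makes them a commutative monoid, and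
adjoining a maximum turns (the class of) a forest into a tree. -/
def Shape : Type 1 := Quotient FinPoset.isoSetoid

namespace Shape

/-- The isomorphism class of a finite poset. -/
def of (P : Type) [PartialOrder P] [Finite P] : Shape := Quotient.mk FinPoset.isoSetoid ⟨P⟩

theorem of_eq_of {P Q : Type} [PartialOrder P] [Finite P] [PartialOrder Q] [Finite Q] :
    of P = of Q ↔ Nonempty (P ≃o Q) := Quotient.eq

theorem exists_eq_of (F : Shape) :
    ∃ (P : Type) (_ : PartialOrder P) (_ : Finite P), F = of P := by
  obtain ⟨⟨P⟩, rfl⟩ := Quotient.exists_rep F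
  exact ⟨P, _, _, rfl⟩

instance : Zero Shape := ⟨of Empty⟩

instance : Add Shape :=
  ⟨Quotient.map₂ (fun P Q => ⟨P.carrier ⊕ Q.carrier⟩)
    fun _ _ ⟨e⟩ _ _ ⟨f⟩ => ⟨OrderIso.sumCongr e f⟩⟩

theorem of_add_of (P Q : Type) [PartialOrder P] [Finite P] [PartialOrder Q] [Finite Q] :
    of P + of Q = of (P ⊕ Q) := rfl

theorem of_eq_zero_iff {P : Type} [PartialOrder P] [Finite P] : of P = 0 ↔ IsEmpty P :=
  of_eq_of.trans
    ⟨fun ⟨e⟩ => e.toEquiv.isEmpty, fun _ => ⟨OrderIso.ofIsEmpty P Empty⟩⟩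

protected theorem add_comm (F G : Shape) : F + G = G + F := by
  obtain ⟨P, _, _, rfl⟩ := F.exists_eq_of
  obtain ⟨Q, _, _, rfl⟩ := G.exists_eq_of
  exact of_eq_of.2 ⟨OrderIso.sumComm P Q⟩

protected theorem zero_add (F : Shape) : 0 + F = F := by
  obtain ⟨P, _, _, rfl⟩ := F.exists_eq_of
  refine of_eq_of.2 ⟨(⟨Equiv.emptySum Empty P, ?_⟩ : Empty ⊕ P ≃o P)⟩
  rintro (⟨⟨⟩⟩ | a) (⟨⟨⟩⟩ | b)
  exact Sum.inr_le_inr_iff.symm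

instance : AddCommMonoid Shape where
  add_assoc F G H := by
    obtain ⟨P, _, _, rfl⟩ := F.exists_eq_of
    obtain ⟨Q, _, _, rfl⟩ := G.exists_eq_of
    obtain ⟨R, _, _, rfl⟩ := H.exists_eq_of
    exact of_eq_of.2 ⟨OrderIso.sumAssoc P Q R⟩
  zero_add := Shape.zero_add
  add_zero F := by rw [Shape.add_comm, Shape.zero_add]
  add_comm := Shape.add_comm
  nsmul := nsmulRec

theorem of_sigma_fin {k : ℕ} (P : Fin k → Type) [∀ i, PartialOrder (P i)] [∀ i, Finite (P i)] :
    of (Σ i, P i) = ∑ i, of (P i) := by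
  induction k with
  | zero => exact of_eq_zero_iff.2 inferInstance
  | succ k ih =>
    rw [Fin.sum_univ_succ, ← ih, of_add_of]
    exact (of_eq_of.2 ⟨sumSigmaFinOrderIso P⟩).symm

/-- The class of the poset with a maximum adjoined. -/
def withTop : Shape → Shape :=
  Quotient.map (fun P => ⟨WithTop P.carrier⟩) fun _ _ ⟨e⟩ => ⟨e.withTopCongr⟩

theorem withTop_of (P : Type) [PartialOrder P] [Finite P] : (of P).withTop = of (WithTop P) := rfl

theorem withTop_injective : Function.Injective withTop := by
  intro F G h
  obtain ⟨P, _, _, rfl⟩ := F.exists_eq_of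
  obtain ⟨Q, _, _, rfl⟩ := G.exists_eq_of
  obtain ⟨e⟩ := of_eq_of.1 h
  exact of_eq_of.2 ⟨orderIsoOfWithTop e⟩

/-- The number of elements. -/
noncomputable def card : Shape → ℕ :=
  Quotient.lift (fun P => Nat.card P.carrier) fun _ _ ⟨e⟩ => Nat.card_congr e.toEquiv

/-- The number of minimal elements. -/
noncomputable def leaves : Shape → ℕ :=
  Quotient.lift (fun P => leafCount P.carrier) fun _ _ ⟨e⟩ => leafCount_congr e

/-- The number of maximal elements. -/
noncomputable def tops : Shape → ℕ :=
  Quotient.lift (fun P => maxCount P.carrier) fun _ _ ⟨e⟩ => maxCount_congr e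

section

variable (P : Type) [PartialOrder P] [Finite P]

theorem card_of : (of P).card = Nat.card P := rfl

theorem leaves_of : (of P).leaves = leafCount P := rfl

theorem tops_of : (of P).tops = maxCount P := rfl

end

theorem card_add (F G : Shape) : (F + G).card = F.card + G.card := by
  obtain ⟨P, _, _, rfl⟩ := F.exists_eq_of
  obtain ⟨Q, _, _, rfl⟩ := G.exists_eq_of
  exact Nat.card_sum

theorem card_withTop (F : Shape) : F.withTop.card = F.card + 1 := by
  obtain ⟨P, _, _, rfl⟩ := F.exists_eq_of
  exact Finite.card_option

theorem card_eq_zero {F : Shape} : F.card = 0 ↔ F = 0 := by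
  obtain ⟨P, _, _, rfl⟩ := F.exists_eq_of
  rw [card_of, of_eq_zero_iff, Finite.card_eq_zero_iff]

theorem card_zero : (0 : Shape).card = 0 := card_eq_zero.2 rfl

theorem card_pos {F : Shape} (h : F ≠ 0) : 0 < F.card :=
  Nat.pos_of_ne_zero fun h' => h (card_eq_zero.1 h')

theorem withTop_ne_zero (F : Shape) : F.withTop ≠ 0 := fun h => by
  simpa [h, card_zero] using F.card_withTop

theorem add_eq_zero_iff {F G : Shape} : F + G = 0 ↔ F = 0 ∧ G = 0 := by
  rw [← card_eq_zero, card_add, Nat.add_eq_zero_iff, card_eq_zero, card_eq_zero]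

theorem leaves_add (F G : Shape) : (F + G).leaves = F.leaves + G.leaves := by
  obtain ⟨P, _, _, rfl⟩ := F.exists_eq_of
  obtain ⟨Q, _, _, rfl⟩ := G.exists_eq_of
  exact leafCount_sum

theorem leaves_pos {F : Shape} (h : F ≠ 0) : 0 < F.leaves := by
  obtain ⟨P, _, _, rfl⟩ := F.exists_eq_of
  rw [Ne, of_eq_zero_iff, not_isEmpty_iff] at h
  exact leafCount_pos

theorem leaves_withTop_zero : (withTop 0).leaves = 1 := by
  change leafCount (WithTop Empty) = 1
  rw [leafCount_withTop, maxCount_of_isEmpty, leafCount_of_isEmpty, if_pos rfl]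

theorem tops_zero : (0 : Shape).tops = 0 := maxCount_of_isEmpty (P := Empty)

theorem tops_add (F G : Shape) : (F + G).tops = F.tops + G.tops := by
  obtain ⟨P, _, _, rfl⟩ := F.exists_eq_of
  obtain ⟨Q, _, _, rfl⟩ := G.exists_eq_of
  exact maxCount_sum

theorem tops_pos {F : Shape} (h : F ≠ 0) : 0 < F.tops := by
  obtain ⟨P, _, _, rfl⟩ := F.exists_eq_of
  rw [Ne, of_eq_zero_iff, not_isEmpty_iff] at h
  exact maxCount_pos

theorem tops_withTop (F : Shape) : F.withTop.tops = 1 := by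
  obtain ⟨P, _, _, rfl⟩ := F.exists_eq_of
  exact maxCount_withTop

theorem leaves_withTop {F : Shape} (h : F ≠ 0) : F.withTop.leaves = F.leaves := by
  have htops := (tops_pos h).ne'
  obtain ⟨P, _, _, rfl⟩ := F.exists_eq_of
  rw [tops_of] at htops
  rw [withTop_of, leaves_of, leafCount_withTop, if_neg htops, zero_add, leaves_of]

theorem eq_zero_or_of_add_eq_withTop {F G H : Shape} (h : F + G = H.withTop) :
    F = 0 ∨ G = 0 := by
  by_contra! hne
  have hF := tops_pos hne.1
  have hG := tops_pos hne.2
  have hFG := tops_add F G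
  rw [h, tops_withTop] at hFG
  omega

theorem finite_setOf_add_eq (F : Shape) : {p : Shape × Shape | p.1 + p.2 = F}.Finite := by
  obtain ⟨R, _, _, rfl⟩ := F.exists_eq_of
  refine (Set.finite_range fun s : Set R × Set R => (of s.1, of s.2)).subset ?_
  rintro ⟨F, G⟩ h
  obtain ⟨P, _, _, rfl⟩ := F.exists_eq_of
  obtain ⟨Q, _, _, rfl⟩ := G.exists_eq_of
  obtain ⟨e⟩ := of_eq_of.1 h
  let f : P ↪o R := (inlInitialSeg : P ≤i P ⊕ Q).toOrderEmbedding.trans e.toOrderEmbedding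
  let g : Q ↪o R := (inrInitialSeg : Q ≤i P ⊕ Q).toOrderEmbedding.trans e.toOrderEmbedding
  exact ⟨(Set.range f, Set.range g), Prod.ext (of_eq_of.2 ⟨f.orderIso.symm⟩)
    (of_eq_of.2 ⟨g.orderIso.symm⟩)⟩

noncomputable instance : Finset.HasAntidiagonal Shape where
  antidiagonal F := (finite_setOf_add_eq F).toFinset
  mem_antidiagonal := by simp

open Finset.HasAntidiagonal (antidiagonal mem_antidiagonal)

open scoped Classical in
/-- The pairs of nonempty classes with a given disjoint union. -/
noncomputable def properAntidiagonal (F : Shape) : Finset (Shape × Shape) :=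
  (antidiagonal F).filter fun p => p.1 ≠ 0 ∧ p.2 ≠ 0

theorem mem_properAntidiagonal {F : Shape} {p : Shape × Shape} :
    p ∈ F.properAntidiagonal ↔ p.1 + p.2 = F ∧ p.1 ≠ 0 ∧ p.2 ≠ 0 := by
  simp [properAntidiagonal]

theorem card_lt_of_mem_properAntidiagonal {F : Shape} {p : Shape × Shape}
    (hp : p ∈ F.properAntidiagonal) : p.1.card < F.card ∧ p.2.card < F.card := by
  obtain ⟨rfl, h1, h2⟩ := mem_properAntidiagonal.1 hp
  have := card_pos h1
  have := card_pos h2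
  rw [card_add]
  omega

theorem properAntidiagonal_withTop (F : Shape) : F.withTop.properAntidiagonal = ∅ := by
  refine Finset.eq_empty_of_forall_notMem fun p hp => ?_
  obtain ⟨h, h1, h2⟩ := mem_properAntidiagonal.1 hp
  exact (eq_zero_or_of_add_eq_withTop h).elim h1 h2

theorem antidiagonal_zero : antidiagonal (0 : Shape) = {(0, 0)} := by
  ext p
  simp [add_eq_zero_iff, Prod.ext_iff]

theorem sum_antidiagonal {M : Type*} [AddCommMonoid M] {F : Shape} (hF : F ≠ 0)
    (g : Shape × Shape → M) :
    ∑ p ∈ antidiagonal F, g p = g (0, F) + g (F, 0) + ∑ p ∈ F.properAntidiagonal, g p := by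
  classical
  have himproper : (antidiagonal F).filter (fun p => ¬(p.1 ≠ 0 ∧ p.2 ≠ 0)) = {(0, F), (F, 0)} := by
    ext ⟨G, H⟩
    simp only [Finset.mem_filter, mem_antidiagonal, Finset.mem_insert, Finset.mem_singleton,
      Prod.mk.injEq]
    constructor
    · rintro ⟨rfl, h⟩
      by_cases hG : G = 0 <;> simp_all
    · rintro (⟨rfl, rfl⟩ | ⟨rfl, rfl⟩) <;> simp
  rw [← Finset.sum_filter_not_add_sum_filter (antidiagonal F) (fun p => p.1 ≠ 0 ∧ p.2 ≠ 0),
    himproper, Finset.sum_pair fun h => hF (Prod.ext_iff.1 h).2, properAntidiagonal]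

end Shape

/-! ### Posets with marked elements -/

section MarkedPoset

variable {P Q R : Type*} [PartialOrder P] [PartialOrder Q] [PartialOrder R]

/-- Isomorphism of posets with distinguished (marked) subsets. -/
def MarkedIso (E : Set P) (E' : Set Q) : Prop := ∃ φ : P ≃o Q, ∀ x, φ x ∈ E' ↔ x ∈ E

namespace MarkedIso

theorem refl (E : Set P) : MarkedIso E E := ⟨OrderIso.refl _, fun _ => Iff.rfl⟩

theorem symm {E : Set P} {E' : Set Q} : MarkedIso E E' → MarkedIso E' E :=
  fun ⟨φ, h⟩ => ⟨φ.symm, fun x => by rw [← h, φ.apply_symm_apply]⟩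

theorem trans {E : Set P} {E' : Set Q} {E'' : Set R} :
    MarkedIso E E' → MarkedIso E' E'' → MarkedIso E E'' :=
  fun ⟨φ, h⟩ ⟨ψ, h'⟩ => ⟨φ.trans ψ, fun x => (h' _).trans (h x)⟩

theorem nonempty_orderIso {E : Set P} {E' : Set Q} : MarkedIso E E' → Nonempty (E ≃o E') :=
  fun ⟨φ, h⟩ => ⟨⟨φ.toEquiv.subtypeEquiv fun x => (h x).symm, φ.le_iff_le⟩⟩

end MarkedIso

theorem image_eq_iff_forall_mem {E : Set P} {E' : Set Q} (φ : P ≃o Q) :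
    φ '' E = E' ↔ ∀ x, φ x ∈ E' ↔ x ∈ E := by
  constructor
  · rintro rfl x
    simp
  · intro h
    ext y
    obtain ⟨x, rfl⟩ := φ.surjective y
    simp [h]

/-- The marked elements below a given element. -/
def markedBelow (E : Set P) (y : P) : Set (Set.Iic y) := {a | (a : P) ∈ E}

/-- A symmetry node: an element covering two elements that are the maxima of isomorphic marked
posets. -/
def IsSymmetric (E : Set P) (x : P) : Prop :=
  ∃ y y', y ⋖ x ∧ y' ⋖ x ∧ y ≠ y' ∧ MarkedIso (markedBelow E y) (markedBelow E y')

theorem markedIso_markedBelow_top [OrderTop P] (E : Set P) : MarkedIso (markedBelow E ⊤) E :=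
  ⟨⟨⟨Subtype.val, fun x => ⟨x, le_top⟩, fun _ => rfl, fun _ => rfl⟩, Iff.rfl⟩, fun _ => Iff.rfl⟩

section

variable (f : P ≤i Q) {E : Set P} {E' : Set Q} (h : ∀ x, f x ∈ E' ↔ x ∈ E)
include h

theorem markedIso_markedBelow (y : P) : MarkedIso (markedBelow E y) (markedBelow E' (f y)) := by
  refine ⟨RelIso.ofSurjective (OrderEmbedding.ofMapLEIff
    (fun a : Set.Iic y => (⟨f a, f.le_iff_le.2 a.2⟩ : Set.Iic (f y)))
    fun _ _ => f.le_iff_le) ?_, fun x => h x⟩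
  rintro ⟨b, hb⟩
  obtain ⟨c, hc, rfl⟩ := f.le_apply_iff.1 (Set.mem_Iic.1 hb)
  exact ⟨⟨c, hc⟩, rfl⟩

theorem isSymmetric_initialSeg_iff (x : P) : IsSymmetric E' (f x) ↔ IsSymmetric E x := by
  constructor
  · rintro ⟨y, y', hy, hy', hne, hiso⟩
    obtain ⟨z, hz, rfl⟩ := (covBy_initialSeg_iff f).1 hy
    obtain ⟨z', hz', rfl⟩ := (covBy_initialSeg_iff f).1 hy'
    exact ⟨z, z', hz, hz', fun e => hne (congrArg f e), (markedIso_markedBelow f h z).trans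
      (hiso.trans (markedIso_markedBelow f h z').symm)⟩
  · rintro ⟨z, z', hz, hz', hne, hiso⟩
    exact ⟨f z, f z', f.apply_covBy_apply_iff.2 hz, f.apply_covBy_apply_iff.2 hz',
      fun e => hne (f.inj.1 e), (markedIso_markedBelow f h z).symm.trans
      (hiso.trans (markedIso_markedBelow f h z'))⟩

end

/-- The local condition at `x` for a marked poset to be a binarization of the poset of its marked
elements: an unmarked `x` covers two elements, and a marked `x` covers two elements, or less if it
covers less than two elements in the poset of marked elements. -/
def IsBinarizedAt (E : Set P) (x : P) : Prop :=
  (x ∉ E → outDegree x = 2) ∧ ∀ hx : x ∈ E, outDegree x = min 2 (outDegree (⟨x, hx⟩ : E))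

theorem isBinarizedAt_initialSeg_iff (f : P ≤i Q) {E : Set P} {E' : Set Q}
    (h : ∀ x, f x ∈ E' ↔ x ∈ E) (x : P) : IsBinarizedAt E' (f x) ↔ IsBinarizedAt E x := by
  simp only [IsBinarizedAt, h, outDegree_initialSeg]
  refine and_congr_right fun _ => forall_congr' fun hx => ?_
  rw [outDegree_restrict f h x hx]

theorem MarkedIso.forall_isBinarizedAt {E : Set P} {E' : Set Q} :
    MarkedIso E E' → (∀ x, IsBinarizedAt E x) → ∀ y, IsBinarizedAt E' y := by
  rintro ⟨φ, h⟩ hE y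
  obtain ⟨x, rfl⟩ := φ.surjective y
  exact (isBinarizedAt_initialSeg_iff φ.toInitialSeg h x).2 (hE x)

theorem MarkedIso.ncard_isSymmetric {E : Set P} {E' : Set Q} :
    MarkedIso E E' → {x | IsSymmetric E x}.ncard = {x | IsSymmetric E' x}.ncard :=
  fun ⟨φ, h⟩ => ncard_setOf_congr φ.toEquiv fun x =>
    (isSymmetric_initialSeg_iff φ.toInitialSeg h x).symm

end MarkedPoset

section Node

variable {ι κ : Type*} {P : ι → Type*} [∀ i, PartialOrder (P i)]
  {Q : κ → Type*} [∀ i, PartialOrder (Q i)]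

/-- The inclusion of a branch as an initial segment of the tree with given branches. -/
def branchInitialSeg (i : ι) : P i ≤i WithTop (Σ i, P i) :=
  (sigmaInitialSeg i).trans withTopInitialSeg

theorem forall_withTop_sigma {p : WithTop (Σ i, P i) → Prop} :
    (∀ x, p x) ↔ p ⊤ ∧ ∀ i x, p (branchInitialSeg i x) :=
  WithTop.forall.trans (and_congr_right fun _ => Sigma.forall)

theorem ne_of_branchInitialSeg_ne {i j : ι} {x : P i} {y : P j} (hij : i ≠ j) :
    branchInitialSeg i x ≠ branchInitialSeg j y :=
  fun h => hij (Sigma.mk.inj (WithTop.coe_injective h)).1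

theorem ncard_setOf_withTop_sigma [Fintype ι] [∀ i, Finite (P i)] (p : WithTop (Σ i, P i) → Prop)
    [Decidable (p ⊤)] :
    {x | p x}.ncard = (if p ⊤ then 1 else 0) + ∑ i, {x | p (branchInitialSeg i x)}.ncard := by
  rw [ncard_setOf_withTop, ncard_setOf_sigma]
  congr

/-- The marked poset with given marked branches, whose maximum is marked or not. -/
def nodeSet (b : Bool) (E : ∀ i, Set (P i)) : Set (WithTop (Σ i, P i)) :=
  {x | WithTop.recTopCoe (C := fun _ => Prop) (b = true) (fun y => y.2 ∈ E y.1) x}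

omit [∀ i, PartialOrder (P i)] in
theorem top_mem_nodeSet {b : Bool} {E : ∀ i, Set (P i)} : ⊤ ∈ nodeSet b E ↔ b = true := Iff.rfl

theorem branchInitialSeg_mem_nodeSet {b : Bool} {E : ∀ i, Set (P i)} {i : ι} (x : P i) :
    branchInitialSeg i x ∈ nodeSet b E ↔ x ∈ E i := Iff.rfl

theorem exists_eq_nodeSet (E : Set (WithTop (Σ i, P i))) :
    ∃ (b : Bool) (E' : ∀ i, Set (P i)), E = nodeSet b E' := by
  classical
  refine ⟨decide (⊤ ∈ E), fun i => {x | branchInitialSeg i x ∈ E}, Set.ext ?_⟩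
  exact forall_withTop_sigma.2 ⟨by simp [top_mem_nodeSet], fun _ _ => Iff.rfl⟩

section OrderTop

variable [∀ i, OrderTop (P i)]

theorem covBy_top_withTop_sigma_iff {y : WithTop (Σ i, P i)} :
    y ⋖ ⊤ ↔ ∃ i, y = branchInitialSeg i ⊤ := by
  have hmax (a : Σ i, P i) : IsMax a ↔ a = ⟨a.1, ⊤⟩ := by
    obtain ⟨i, x⟩ := a
    constructor
    · intro h
      have hx : (⟨i, ⊤⟩ : Σ i, P i) ≤ ⟨i, x⟩ := h (Sigma.mk_le_mk_iff.2 le_top)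
      exact congrArg (Sigma.mk i) (top_le_iff.1 (Sigma.mk_le_mk_iff.1 hx))
    · rintro hx ⟨j, y⟩ h
      obtain ⟨hij, -⟩ := Sigma.le_def.1 h
      obtain rfl : i = j := hij
      rw [hx]
      exact Sigma.mk_le_mk_iff.2 le_top
  rw [WithTop.covBy_top_iff]
  constructor
  · rintro ⟨a, ha, rfl⟩
    exact ⟨a.1, congrArg WithTop.some ((hmax a).1 ha)⟩
  · rintro ⟨i, rfl⟩
    exact ⟨⟨i, ⊤⟩, (hmax _).2 rfl, rfl⟩

theorem outDegree_top_withTop_sigma [Fintype ι] :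
    outDegree (⊤ : WithTop (Σ i, P i)) = Fintype.card ι := by
  have hcov : {y : WithTop (Σ i, P i) | y ⋖ ⊤} = Set.range fun i => branchInitialSeg i ⊤ := by
    ext y
    rw [Set.mem_ofPred_eq, covBy_top_withTop_sigma_iff]
    exact exists_congr fun i => eq_comm
  have hinj : Function.Injective fun i => (branchInitialSeg i ⊤ : WithTop (Σ i, P i)) :=
    fun i j h => by_contra fun hij => ne_of_branchInitialSeg_ne hij h
  rw [outDegree, hcov, ← Set.image_univ, Set.ncard_image_of_injective _ hinj, Set.ncard_univ,
    Nat.card_eq_fintype_card]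

theorem isSymmetric_top_nodeSet_iff {b : Bool} {E : ∀ i, Set (P i)} :
    IsSymmetric (nodeSet b E) ⊤ ↔ ∃ i j, i ≠ j ∧ MarkedIso (E i) (E j) := by
  have hbranch (i : ι) : MarkedIso (E i) (markedBelow (nodeSet b E) (branchInitialSeg i ⊤)) :=
    (markedIso_markedBelow_top _).symm.trans
      (markedIso_markedBelow _ branchInitialSeg_mem_nodeSet _)
  constructor
  · rintro ⟨y, y', hy, hy', hne, h⟩
    obtain ⟨i, rfl⟩ := covBy_top_withTop_sigma_iff.1 hy
    obtain ⟨j, rfl⟩ := covBy_top_withTop_sigma_iff.1 hy'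
    exact ⟨i, j, fun e => hne (e ▸ rfl), (hbranch i).trans (h.trans (hbranch j).symm)⟩
  · rintro ⟨i, j, hij, h⟩
    exact ⟨_, _, covBy_top_withTop_sigma_iff.2 ⟨i, rfl⟩, covBy_top_withTop_sigma_iff.2 ⟨j, rfl⟩,
      ne_of_branchInitialSeg_ne hij, (hbranch i).symm.trans (h.trans (hbranch j))⟩

theorem fst_apply_eq_fst_apply_top (φ : (Σ i, P i) ≃o Σ j, Q j) (i : ι) (x : P i) :
    (φ ⟨i, x⟩).1 = (φ ⟨i, ⊤⟩).1 :=
  (Sigma.le_def.1 (φ.le_iff_le.2 (Sigma.mk_le_mk_iff.2 (le_top (a := x))))).1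

variable [∀ j, OrderTop (Q j)]

/-- The bijection between the summands induced by an isomorphism of disjoint unions of posets with
maxima. -/
def sigmaIndexEquiv (φ : (Σ i, P i) ≃o Σ j, Q j) : ι ≃ κ where
  toFun i := (φ ⟨i, ⊤⟩).1
  invFun j := (φ.symm ⟨j, ⊤⟩).1
  left_inv i :=
    (fst_apply_eq_fst_apply_top φ.symm _ (φ ⟨i, ⊤⟩).2).symm.trans
      (congrArg Sigma.fst (φ.symm_apply_apply _))
  right_inv j :=
    (fst_apply_eq_fst_apply_top φ _ (φ.symm ⟨j, ⊤⟩).2).symm.trans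
      (congrArg Sigma.fst (φ.apply_symm_apply _))

theorem exists_orderIso_of_sigma (φ : (Σ i, P i) ≃o Σ j, Q j) :
    ∃ (σ : ι ≃ κ) (ψ : ∀ i, P i ≃o Q (σ i)), ∀ i x, φ ⟨i, x⟩ = ⟨σ i, ψ i x⟩ := by
  have happly (i : ι) (x : P i) : ∃ y, φ ⟨i, x⟩ = ⟨sigmaIndexEquiv φ i, y⟩ := by
    have hfst : (φ ⟨i, x⟩).1 = sigmaIndexEquiv φ i := fst_apply_eq_fst_apply_top φ i x
    rw [← hfst]
    exact ⟨_, rfl⟩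
  choose f hf using happly
  have hle (i : ι) (x y : P i) : f i x ≤ f i y ↔ x ≤ y := by
    rw [← Sigma.mk_le_mk_iff, ← hf, ← hf, φ.le_iff_le, Sigma.mk_le_mk_iff]
  refine ⟨sigmaIndexEquiv φ, fun i => RelIso.ofSurjective
    (OrderEmbedding.ofMapLEIff (f i) (hle i)) fun y => ?_, hf⟩
  obtain ⟨⟨j, x⟩, hx⟩ := φ.surjective ⟨sigmaIndexEquiv φ i, y⟩
  rw [hf] at hx
  obtain rfl : j = i := (sigmaIndexEquiv φ).injective (Sigma.mk.inj hx).1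
  exact ⟨x, sigma_mk_injective hx⟩

theorem markedIso_nodeSet_iff {b b' : Bool} {E : ∀ i, Set (P i)} {E' : ∀ i, Set (Q i)} :
    MarkedIso (nodeSet b E) (nodeSet b' E') ↔
      b = b' ∧ ∃ σ : ι ≃ κ, ∀ i, MarkedIso (E i) (E' (σ i)) := by
  constructor
  · rintro ⟨φ, h⟩
    have htop := h ⊤
    rw [φ.map_top, top_mem_nodeSet, top_mem_nodeSet] at htop
    obtain ⟨σ, ψ, hφ⟩ := exists_orderIso_of_sigma (orderIsoOfWithTop φ)
    refine ⟨(Bool.eq_iff_iff.2 htop).symm, σ, fun i => ⟨ψ i, fun x => ?_⟩⟩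
    have hx : φ (branchInitialSeg i x) = branchInitialSeg (σ i) (ψ i x) :=
      (coe_orderIsoOfWithTop φ _).symm.trans (congrArg WithTop.some (hφ i x))
    rw [← branchInitialSeg_mem_nodeSet (b := b') (E := E'), ← hx, h, branchInitialSeg_mem_nodeSet]
  · rintro ⟨rfl, σ, h⟩
    choose ψ hψ using h
    exact ⟨(sigmaCongrOrderIso σ ψ).withTopCongr, forall_withTop_sigma.2 ⟨Iff.rfl, hψ⟩⟩

end OrderTop

theorem sigma_map_val_le_iff (E : ∀ i, Set (P i)) {x y : Σ i, E i} :
    Sigma.map id (fun i (a : E i) => (a : P i)) x ≤ Sigma.map id (fun i (a : E i) => (a : P i)) y ↔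
      x ≤ y :=
  sigma_map_le_iff (P := fun i => E i) (Q := P) (g := fun _ a => a.1) Function.injective_id
    fun _ _ _ => Iff.rfl

/-- The marked elements when the maximum is unmarked. -/
noncomputable def nodeSetFalseIso (E : ∀ i, Set (P i)) : (Σ i, E i) ≃o nodeSet false E :=
  RelIso.ofSurjective
    (OrderEmbedding.ofMapLEIff (fun x => ⟨branchInitialSeg x.1 x.2.1, x.2.2⟩) fun _ _ =>
      WithTop.coe_le_coe.trans (sigma_map_val_le_iff E)) <| by
    rintro ⟨x, hx⟩
    induction x with
    | top => simp [top_mem_nodeSet] at hx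
    | coe y => exact ⟨⟨y.1, y.2, hx⟩, rfl⟩

/-- The marked elements when the maximum is marked. -/
noncomputable def nodeSetTrueIso (E : ∀ i, Set (P i)) : WithTop (Σ i, E i) ≃o nodeSet true E :=
  RelIso.ofSurjective
    (OrderEmbedding.ofMapLEIff
      (fun x => ⟨x.map (Sigma.map id fun _ => Subtype.val), by
        induction x with
        | top => exact top_mem_nodeSet.2 rfl
        | coe y => exact y.2.2⟩) fun _ _ =>
      WithTop.map_le_iff _ (sigma_map_val_le_iff E)) <| by
    rintro ⟨x, hx⟩
    induction x with
    | top => exact ⟨⊤, rfl⟩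
    | coe y => exact ⟨((⟨y.1, y.2, hx⟩ : Σ i, E i) : WithTop (Σ i, E i)), rfl⟩

theorem outDegree_top_nodeSet (E : ∀ i, Set (P i)) (h : ⊤ ∈ nodeSet true E) :
    outDegree (⟨⊤, h⟩ : nodeSet true E) = maxCount (Σ i, E i) := by
  rw [← outDegree_top_withTop, ← outDegree_orderIso (nodeSetTrueIso E) ⊤]
  rfl

theorem forall_isBinarizedAt_nodeSet_iff [Fintype ι] [∀ i, OrderTop (P i)] {b : Bool}
    {E : ∀ i, Set (P i)} :
    (∀ x, IsBinarizedAt (nodeSet b E) x) ↔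
      (Fintype.card ι = if b then min 2 (maxCount (Σ i, E i)) else 2) ∧
        ∀ i x, IsBinarizedAt (E i) x := by
  rw [forall_withTop_sigma]
  refine and_congr ?_ (forall₂_congr fun i x => isBinarizedAt_initialSeg_iff (branchInitialSeg i)
    branchInitialSeg_mem_nodeSet x)
  rw [IsBinarizedAt, outDegree_top_withTop_sigma]
  cases b
  · simp [top_mem_nodeSet]
  · simp [top_mem_nodeSet, outDegree_top_nodeSet]

end Node

/-! ### Isomorphism classes of marked trees -/

theorem exists_equiv_of_map_univ_eq {ι κ α : Type*} [Fintype ι] [Fintype κ] {f : ι → α}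
    {g : κ → α} (h : Finset.univ.val.map f = Finset.univ.val.map g) :
    ∃ σ : ι ≃ κ, ∀ i, g (σ i) = f i := by
  classical
  have hfiber (a : α) : Nonempty ({i // f i = a} ≃ {j // g j = a}) := by
    refine Fintype.card_eq.1 ?_
    have hcount := congrArg (Multiset.count a) h
    rw [Multiset.count_map, Multiset.count_map] at hcount
    simp only [Fintype.card_subtype, eq_comm (b := a)]
    exact hcount
  let e (a : α) := (hfiber a).some
  exact ⟨Equiv.ofFiberEquiv e, Equiv.ofFiberEquiv_map e⟩

theorem map_univ_eq_iff {ι κ α : Type*} [Fintype ι] [Fintype κ] {f : ι → α} {g : κ → α} :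
    Finset.univ.val.map f = Finset.univ.val.map g ↔ ∃ σ : ι ≃ κ, ∀ i, f i = g (σ i) := by
  refine ⟨fun h => (exists_equiv_of_map_univ_eq h).imp fun _ hσ i => (hσ i).symm, ?_⟩
  rintro ⟨σ, hσ⟩
  rw [← Multiset.map_univ_val_equiv σ, Multiset.map_map]
  exact Multiset.map_congr rfl fun i _ => hσ i

instance finite_vertex : (T : FinRootedTree) → Finite T.Vertex
  | node _ child =>
    letI := fun i => finite_vertex (child i)
    inferInstanceAs (Finite (Option (Σ i, (child i).Vertex)))

theorem isBinary_of_orderIso {T T' : FinRootedTree} (e : T.Vertex ≃o T'.Vertex) (h : T.IsBinary) :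
    T'.IsBinary := fun y => by
  obtain ⟨x, rfl⟩ := e.surjective y
  rw [outDegree_orderIso]
  exact h x

theorem isBinary_node {k : ℕ} {c : Fin k → FinRootedTree} :
    (node k c).IsBinary ↔ (k = 0 ∨ k = 2) ∧ ∀ i, (c i).IsBinary := by
  have htop : outDegree (⊤ : WithTop (Σ i, (c i).Vertex)) = k := by
    rw [outDegree_top_withTop_sigma, Fintype.card_fin]
  refine (forall_withTop_sigma (P := fun i => (c i).Vertex)).trans
    (and_congr (iff_of_eq (congrArg (fun d => d = 0 ∨ d = 2) htop))
      (forall₂_congr fun i x => iff_of_eq (congrArg (fun d => d = 0 ∨ d = 2) ?_)))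
  exact outDegree_initialSeg (branchInitialSeg (P := fun i => (c i).Vertex) i) x

theorem size_node {k : ℕ} (c : Fin k → FinRootedTree) :
    (node k c).size = 1 + ∑ i, (c i).size := by
  change Nat.card (Option (Σ i, (c i).Vertex)) = _
  rw [Finite.card_option, Nat.card_sigma, Nat.add_comm]
  rfl

namespace MarkedTree

/-- The marked tree with given branches at the root, which is marked or not. -/
def node (b : Bool) {k : ℕ} (c : Fin k → MarkedTree) : MarkedTree :=
  ⟨.node k fun i => (c i).tree, nodeSet b fun i => (c i).original⟩

theorem exists_eq_node (t : MarkedTree) : ∃ (b : Bool) (k : ℕ) (c : Fin k → MarkedTree),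
    t = node b c := by
  obtain ⟨⟨k, child⟩, E⟩ := t
  obtain ⟨b, E', rfl⟩ := exists_eq_nodeSet (P := fun i => (child i).Vertex) E
  exact ⟨b, k, fun i => ⟨child i, E' i⟩, rfl⟩

open scoped Classical in
theorem numSymmetryNodes_node (b : Bool) {k : ℕ} (c : Fin k → MarkedTree) :
    (node b c).numSymmetryNodes =
      (if ∃ i j, i ≠ j ∧ MarkedIso (c i).original (c j).original then 1 else 0) +
        ∑ i, (c i).numSymmetryNodes := by
  change {x | IsSymmetric (nodeSet b fun i => (c i).original) x}.ncard = _
  rw [ncard_setOf_withTop_sigma]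
  refine congrArg₂ _ (if_congr isSymmetric_top_nodeSet_iff rfl rfl)
    (Finset.sum_congr rfl fun i _ => congrArg Set.ncard (Set.ext fun x => ?_))
  exact isSymmetric_initialSeg_iff (branchInitialSeg (P := fun i => (c i).tree.Vertex) i)
    (branchInitialSeg_mem_nodeSet (E := fun i => (c i).original)) x

end MarkedTree

instance markedSetoid : Setoid MarkedTree where
  r t t' := MarkedIso t.original t'.original
  iseqv := ⟨fun _ => .refl _, .symm, .trans⟩

/-- Isomorphism classes of trees with distinguished (marked) vertices. -/
def TreeClass : Type := Quotient markedSetoid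

namespace TreeClass

/-- The isomorphism class of a marked tree. -/
def mk (t : MarkedTree) : TreeClass := Quotient.mk markedSetoid t

theorem mk_eq_mk {t t' : MarkedTree} : mk t = mk t' ↔ MarkedIso t.original t'.original :=
  Quotient.eq

theorem exists_eq_mk (q : TreeClass) : ∃ t, q = mk t := (Quotient.exists_rep q).imp fun _ => Eq.symm

theorem mk_node_eq_mk_node {b b' : Bool} {k k' : ℕ} {c : Fin k → MarkedTree}
    {c' : Fin k' → MarkedTree} : mk (.node b c) = mk (.node b' c') ↔
      b = b' ∧ Finset.univ.val.map (fun i => mk (c i)) =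
        Finset.univ.val.map fun i => mk (c' i) := by
  rw [map_univ_eq_iff]
  simp only [mk_eq_mk]
  exact markedIso_nodeSet_iff (P := fun i => (c i).tree.Vertex)
    (E := fun i => (c i).original) (E' := fun i => (c' i).original)

/-- The number of vertices. -/
noncomputable def size : TreeClass → ℕ :=
  Quotient.lift (fun t => t.tree.size) fun _ _ ⟨φ, _⟩ => Nat.card_congr φ.toEquiv

/-- The poset of marked vertices. -/
def shape : TreeClass → Shape :=
  Quotient.lift (fun t => Shape.of t.original) fun _ _ h =>
    Shape.of_eq_of.2 (MarkedIso.nonempty_orderIso h)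

/-- Every vertex has no or two children, whether marked or not. -/
def IsBinary : TreeClass → Prop :=
  Quotient.lift (fun t => t.tree.IsBinary) fun _ _ ⟨φ, _⟩ =>
    propext ⟨isBinary_of_orderIso φ, isBinary_of_orderIso φ.symm⟩

/-- The tree is a binarization of the poset of its marked vertices. This poset may be a forest: the
root need not be marked. -/
def IsBinarization : TreeClass → Prop :=
  Quotient.lift (fun t => ∀ x, IsBinarizedAt t.original x) fun _ _ h =>
    propext ⟨h.forall_isBinarizedAt, (MarkedIso.symm h).forall_isBinarizedAt⟩

/-- The number of symmetry nodes. -/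
noncomputable def symmetry : TreeClass → ℕ :=
  Quotient.lift (fun t => t.numSymmetryNodes) fun _ _ h => MarkedIso.ncard_isSymmetric h

theorem size_pos (q : TreeClass) : 0 < q.size := by
  obtain ⟨t, rfl⟩ := q.exists_eq_mk
  exact Nat.card_pos (α := t.tree.Vertex)

theorem IsBinarization.shape_ne_zero {q : TreeClass} (h : q.IsBinarization) : q.shape ≠ 0 := by
  obtain ⟨⟨T, E⟩, rfl⟩ := q.exists_eq_mk
  intro h0
  have hE : IsEmpty E := Shape.of_eq_zero_iff.1 h0
  obtain ⟨x, hx⟩ := Set.Finite.exists_minimal (Set.finite_univ (α := T.Vertex)) Set.univ_nonempty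
  have hx0 : outDegree x = 0 := outDegree_eq_zero_iff.2 fun y hy => hx.2 trivial hy
  have hx2 : outDegree x = 2 := (h x).1 fun hxE => hE.false ⟨x, hxE⟩
  omega

section Node

variable {b b' : Bool} {s s' : Multiset TreeClass}

/-- The tree with a given multiset of branches at the root, which is marked or not. -/
noncomputable def node (b : Bool) (s : Multiset TreeClass) : TreeClass :=
  mk (.node b fun i : Fin s.toList.length => (s.toList.get i).out)

theorem mk_out (q : TreeClass) : mk (Quotient.out q) = q := Quotient.out_eq q

theorem map_univ_mk_out (s : Multiset TreeClass) :
    Finset.univ.val.map (fun i : Fin s.toList.length => mk (s.toList.get i).out) = s := by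
  conv_rhs => rw [← s.coe_toList]
  simp only [mk_out, Fin.univ_val_map, List.ofFn_get]

theorem exists_eq_map_mk (s : Multiset TreeClass) :
    ∃ (k : ℕ) (c : Fin k → MarkedTree), s = Finset.univ.val.map fun i => mk (c i) :=
  ⟨_, _, (map_univ_mk_out s).symm⟩

theorem node_map_mk {k : ℕ} (c : Fin k → MarkedTree) :
    node b (Finset.univ.val.map fun i => mk (c i)) = mk (.node b c) :=
  mk_node_eq_mk_node.2 ⟨rfl, map_univ_mk_out _⟩

theorem exists_eq_node (q : TreeClass) : ∃ b s, q = node b s := by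
  obtain ⟨t, rfl⟩ := q.exists_eq_mk
  obtain ⟨b, k, c, rfl⟩ := t.exists_eq_node
  exact ⟨b, _, (node_map_mk c).symm⟩

theorem node_inj : node b s = node b' s' ↔ b = b' ∧ s = s' := by
  obtain ⟨k, c, rfl⟩ := exists_eq_map_mk s
  obtain ⟨k', c', rfl⟩ := exists_eq_map_mk s'
  rw [node_map_mk, node_map_mk, mk_node_eq_mk_node]

theorem size_node : (node b s).size = 1 + (s.map size).sum := by
  obtain ⟨k, c, rfl⟩ := exists_eq_map_mk s
  rw [node_map_mk, Multiset.map_map]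
  exact FinRootedTree.size_node _

theorem of_sigma_original {k : ℕ} (c : Fin k → MarkedTree) :
    Shape.of (Σ i, (c i).original) = ∑ i, (mk (c i)).shape :=
  Shape.of_sigma_fin fun i => ((c i).original : Type)

theorem shape_node :
    (node b s).shape = if b then (s.map shape).sum.withTop else (s.map shape).sum := by
  obtain ⟨k, c, rfl⟩ := exists_eq_map_mk s
  rw [node_map_mk, Multiset.map_map]
  change _ = if b then (∑ i, (mk (c i)).shape).withTop else ∑ i, (mk (c i)).shape
  rw [← of_sigma_original]
  cases b
  · exact (Shape.of_eq_of.2 ⟨nodeSetFalseIso fun i => (c i).original⟩).symm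
  · exact (Shape.of_eq_of.2 ⟨nodeSetTrueIso fun i => (c i).original⟩).symm

theorem isBinary_node :
    (node b s).IsBinary ↔ (s.card = 0 ∨ s.card = 2) ∧ ∀ q ∈ s, q.IsBinary := by
  obtain ⟨k, c, rfl⟩ := exists_eq_map_mk s
  rw [node_map_mk]
  exact Iff.trans (b := (k = 0 ∨ k = 2) ∧ ∀ i, (mk (c i)).IsBinary) FinRootedTree.isBinary_node
    (by simp)

theorem isBinarization_node :
    (node b s).IsBinarization ↔
      (s.card = if b then min 2 (s.map shape).sum.tops else 2) ∧ ∀ q ∈ s, q.IsBinarization := by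
  obtain ⟨k, c, rfl⟩ := exists_eq_map_mk s
  rw [node_map_mk]
  have hnode := forall_isBinarizedAt_nodeSet_iff (b := b) (E := fun i => (c i).original)
  rw [← Shape.tops_of, of_sigma_original, Fintype.card_fin] at hnode
  exact hnode.trans (Iff.trans (b := (k = if b then min 2 (∑ i, (mk (c i)).shape).tops else 2) ∧
    ∀ i, (mk (c i)).IsBinarization) Iff.rfl (by simp [List.sum_ofFn]))

open scoped Classical in
theorem symmetry_node :
    (node b s).symmetry = (if s.Nodup then 0 else 1) + (s.map symmetry).sum := by
  obtain ⟨k, c, rfl⟩ := exists_eq_map_mk s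
  rw [node_map_mk, Multiset.map_map, ← ite_not]
  refine (MarkedTree.numSymmetryNodes_node b c).trans
    (congrArg₂ _ (if_congr ?_ rfl rfl) rfl)
  rw [Multiset.nodup_map_iff_inj_on Finset.univ.nodup]
  simp only [← mk_eq_mk, Finset.mem_val, Finset.mem_univ, true_imp_iff]
  grind

end Node

/-- A single vertex. -/
noncomputable def leaf (b : Bool) : TreeClass := node b 0

/-- A root with one branch. -/
noncomputable def unary (b : Bool) (q : TreeClass) : TreeClass := node b {q}

/-- A root with two branches. -/
noncomputable def binary (b : Bool) (z : Sym2 TreeClass) : TreeClass := node b z.toMultiset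

/-- The trees whose root has at most two branches. -/
noncomputable def ofRoot : Bool × (Unit ⊕ TreeClass ⊕ Sym2 TreeClass) → TreeClass
  | (b, .inl _) => leaf b
  | (b, .inr (.inl q)) => unary b q
  | (b, .inr (.inr z)) => binary b z

theorem toMultiset_injective {α : Type*} :
    Function.Injective (Sym2.toMultiset : Sym2 α → Multiset α) := fun z z' h =>
  Sym2.ext fun x => by rw [← Sym2.mem_toMultiset, h, Sym2.mem_toMultiset]

theorem ofRoot_injective : Function.Injective ofRoot := by
  rintro ⟨b, _ | q | z⟩ ⟨b', _ | q' | z'⟩ h <;> obtain ⟨rfl, hs⟩ := node_inj.1 h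
  case inr.inl.inr.inl => rw [Multiset.singleton_inj.1 hs]
  case inr.inr.inr.inr => rw [toMultiset_injective hs]
  all_goals first
    | rfl
    | exact absurd (congrArg Multiset.card hs) (by simp [Sym2.card_toMultiset])

theorem node_mem_range_ofRoot {b : Bool} {s : Multiset TreeClass} (hs : s.card ≤ 2) :
    node b s ∈ Set.range ofRoot := by
  obtain h | h | h : s.card = 0 ∨ s.card = 1 ∨ s.card = 2 := by omega
  · obtain rfl := Multiset.card_eq_zero.1 h
    exact ⟨(b, .inl ()), rfl⟩
  · obtain ⟨q, rfl⟩ := Multiset.card_eq_one.1 h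
    exact ⟨(b, .inr (.inl q)), rfl⟩
  · obtain ⟨q, q', rfl⟩ := Multiset.card_eq_two.1 h
    exact ⟨(b, .inr (.inr s(q, q'))), rfl⟩

theorem IsBinary.mem_range_ofRoot {q : TreeClass} (h : q.IsBinary) : q ∈ Set.range ofRoot := by
  obtain ⟨b, s, rfl⟩ := q.exists_eq_node
  exact node_mem_range_ofRoot (by have := (isBinary_node.1 h).1; omega)

theorem IsBinarization.mem_range_ofRoot {q : TreeClass} (h : q.IsBinarization) :
    q ∈ Set.range ofRoot := by
  obtain ⟨b, s, rfl⟩ := q.exists_eq_node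
  have hcard := (isBinarization_node.1 h).1
  exact node_mem_range_ofRoot (by split_ifs at hcard <;> omega)

section Recursion

variable {b : Bool} {q q' : TreeClass}

theorem size_leaf : (leaf b).size = 1 := by simp [leaf, size_node]

theorem size_binary : (binary b s(q, q')).size = 1 + q.size + q'.size := by
  simp [binary, size_node, Sym2.toMultiset, add_assoc]

theorem shape_leaf : (leaf b).shape = if b then Shape.withTop 0 else 0 := by
  simp [leaf, shape_node]

theorem shape_unary : (unary b q).shape = if b then q.shape.withTop else q.shape := by
  simp [unary, shape_node]

theorem shape_binary : (binary b s(q, q')).shape =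
    if b then (q.shape + q'.shape).withTop else q.shape + q'.shape := by
  simp [binary, shape_node, Sym2.toMultiset]

theorem isBinary_leaf : (leaf b).IsBinary := by simp [leaf, isBinary_node]

theorem not_isBinary_unary : ¬ (unary b q).IsBinary := by simp [unary, isBinary_node]

theorem isBinary_binary : (binary b s(q, q')).IsBinary ↔ q.IsBinary ∧ q'.IsBinary := by
  simp [binary, isBinary_node, Sym2.toMultiset]

theorem isBinarization_leaf : (leaf b).IsBinarization ↔ b = true := by
  cases b <;> simp [leaf, isBinarization_node, Shape.tops_zero]

theorem isBinarization_unary :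
    (unary b q).IsBinarization ↔ b = true ∧ q.shape.tops = 1 ∧ q.IsBinarization := by
  have hmin : 1 = min 2 q.shape.tops ↔ q.shape.tops = 1 := by omega
  cases b <;> simp [unary, isBinarization_node, hmin]

theorem isBinarization_binary :
    (binary b s(q, q')).IsBinarization ↔ (b = true → 2 ≤ (q.shape + q'.shape).tops) ∧
      q.IsBinarization ∧ q'.IsBinarization := by
  cases b <;> simp [binary, isBinarization_node, Sym2.toMultiset]

theorem symmetry_leaf : (leaf b).symmetry = 0 := by simp [leaf, symmetry_node]

theorem symmetry_unary : (unary b q).symmetry = q.symmetry := by simp [unary, symmetry_node]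

open scoped Classical in
theorem symmetry_binary :
    (binary b s(q, q')).symmetry = (if q = q' then 1 else 0) + q.symmetry + q'.symmetry := by
  simp [binary, symmetry_node, Sym2.toMultiset, add_assoc]

end Recursion

end TreeClass

/-! ### Weighted sums over marked trees -/

section Sym2Sum

variable {X M : Type*}

theorem finite_setOf_sym2Mk_eq (s : Sym2 X) : {p : X × X | s(p.1, p.2) = s}.Finite := by
  induction s with | _ x y
  refine (Set.toFinite {(x, y), (y, x)}).subset fun p hp => ?_
  simpa [Prod.ext_iff] using hp

open scoped Classical in
theorem ncard_setOf_sym2Mk_eq (s : Sym2 X) :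
    {p : X × X | s(p.1, p.2) = s}.ncard = if s.IsDiag then 1 else 2 := by
  induction s with | _ x y
  have hfiber : {p : X × X | s(p.1, p.2) = s(x, y)} = {(x, y), (y, x)} := by
    ext p
    simp [Prod.ext_iff]
  simp only [hfiber, Sym2.mk_isDiag_iff]
  split_ifs with h
  · rw [h, Set.pair_eq_singleton, Set.ncard_singleton]
  · exact Set.ncard_pair fun e => h (Prod.ext_iff.1 e).1

open scoped Classical in
theorem hasSum_sym2 [AddCommMonoid M] [TopologicalSpace M] [ContinuousAdd M] [RegularSpace M]
    {h : Sym2 X → M} {a : M} (hs : HasSum (fun p : X × X => h s(p.1, p.2)) a) :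
    HasSum (fun s => (if s.IsDiag then 1 else 2) • h s) a := by
  refine HasSum.sigma (((Equiv.sigmaFiberEquiv fun p : X × X => s(p.1, p.2)).hasSum_iff).2 hs)
    fun s => ?_
  let fiber := {p : X × X // s(p.1, p.2) = s}
  have : Finite fiber := (finite_setOf_sym2Mk_eq s).to_subtype
  have := Fintype.ofFinite fiber
  have hcard : Fintype.card fiber = if s.IsDiag then 1 else 2 := by
    rw [← Nat.card_eq_fintype_card, ← ncard_setOf_sym2Mk_eq s]
    rfl
  convert hasSum_fintype fun _ : fiber => h s using 1
  · funext p
    exact congrArg h p.2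
  · rw [Finset.sum_const, Finset.card_univ, hcard]

variable {𝕜 : Type*} [RCLike 𝕜] {h : Sym2 X → 𝕜}

theorem summable_of_sym2 (hs : Summable fun p : X × X => h s(p.1, p.2)) : Summable h := by
  classical
  have hnorm := hasSum_sym2 (h := fun s => ‖h s‖) hs.norm.hasSum
  refine Summable.of_norm_bounded hnorm.summable fun s => ?_
  exact le_self_nsmul (norm_nonneg _) (by split_ifs <;> norm_num)

theorem two_mul_tsum_sym2 (hs : Summable fun p : X × X => h s(p.1, p.2)) :
    2 * ∑' s, h s = ∑' p : X × X, h s(p.1, p.2) + ∑' x, h s(x, x) := by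
  classical
  have hweighted := hasSum_sym2 hs.hasSum
  have hh : Summable h := summable_of_sym2 hs
  have hdiag : ∑' x, h s(x, x) = ∑' s, {s : Sym2 X | s.IsDiag}.indicator h s := by
    rw [← Sym2.diag_injective.tsum_eq (f := {s : Sym2 X | s.IsDiag}.indicator h)]
    · exact tsum_congr fun x => (Set.indicator_of_mem (Sym2.diag_isDiag x) h).symm
    · intro s hs
      exact ⟨_, Sym2.diag_diagElem (Set.mem_of_indicator_ne_zero hs)⟩
  rw [hdiag, ← hweighted.tsum_eq, ← hweighted.summable.tsum_add (hh.indicator _), ← tsum_mul_left]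
  refine tsum_congr fun s => ?_
  by_cases hsd : s.IsDiag <;> simp [hsd, two_mul]

end Sym2Sum

namespace TreeClass

open Finset.HasAntidiagonal (antidiagonal mem_antidiagonal)

variable {𝕜 : Type*} [RCLike 𝕜]

open scoped Classical in
/-- The restriction of a weight to the trees whose marked vertices form a given poset. -/
noncomputable def restr (w : TreeClass → 𝕜) (F : Shape) (q : TreeClass) : 𝕜 :=
  if q.shape = F then w q else 0

/-- The total weight of the trees whose marked vertices form a given poset. -/
noncomputable def total (w : TreeClass → 𝕜) (F : Shape) : 𝕜 := ∑' q, restr w F q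

/-- The disjoint union of the posets of marked vertices of two trees. -/
def pairShape : Sym2 TreeClass → Shape :=
  Sym2.lift ⟨fun q q' => q.shape + q'.shape, fun _ _ => add_comm _ _⟩

/-- The product of the weights of two trees. -/
def pairWeight (w : TreeClass → 𝕜) : Sym2 TreeClass → 𝕜 :=
  Sym2.lift ⟨fun q q' => w q * w q', fun _ _ => mul_comm _ _⟩

open scoped Classical in
/-- The restriction of the product weight to the pairs of trees whose marked vertices form,
together, a given poset. -/
noncomputable def pairRestr (w : TreeClass → 𝕜) (F : Shape) (s : Sym2 TreeClass) : 𝕜 :=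
  if pairShape s = F then pairWeight w s else 0

theorem pairRestr_mk (w : TreeClass → 𝕜) (F : Shape) (q q' : TreeClass) :
    pairRestr w F s(q, q') = ∑ p ∈ antidiagonal F, restr w p.1 q * restr w p.2 q' := by
  classical
  have hterm (p : Shape × Shape) : restr w p.1 q * restr w p.2 q' =
      if p = (q.shape, q'.shape) then w q * w q' else 0 := by
    simp only [restr, Prod.ext_iff, eq_comm (a := p.1), eq_comm (a := p.2)]
    split_ifs <;> simp_all
  simp only [hterm, Finset.sum_ite_eq', mem_antidiagonal]
  rfl

open scoped Classical in
theorem pairRestr_diag (w : TreeClass → 𝕜) (F : Shape) (q : TreeClass) :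
    pairRestr w F s(q, q) =
      ∑ p ∈ antidiagonal F with p.1 = p.2, restr (fun q => w q ^ 2) p.1 q := by
  rw [pairRestr_mk, Finset.sum_filter]
  refine Finset.sum_congr rfl fun p _ => ?_
  simp only [restr]
  split_ifs <;> simp_all [sq]

section

variable {w : TreeClass → 𝕜} {F : Shape}

theorem summable_restr_sq (h : Summable (restr w F)) :
    Summable (restr (fun q => w q ^ 2) F) := by
  have hdiag := (summable_mul_of_summable_norm h.norm h.norm).comp_injective
    (i := fun q => (q, q)) fun _ _ e => (Prod.ext_iff.1 e).1
  refine hdiag.congr fun q => ?_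
  simp only [Function.comp_apply, restr]
  split_ifs <;> simp [sq]

variable (hw : ∀ p ∈ antidiagonal F, Summable (restr w p.1) ∧ Summable (restr w p.2))
include hw

theorem hasSum_pairRestr_mk :
    HasSum (fun p : TreeClass × TreeClass => pairRestr w F s(p.1, p.2))
      (∑ p ∈ antidiagonal F, total w p.1 * total w p.2) := by
  simp only [pairRestr_mk]
  refine hasSum_sum fun p hp => ?_
  obtain ⟨h1, h2⟩ := hw p hp
  rw [total, total, tsum_mul_tsum_of_summable_norm h1.norm h2.norm]
  exact (summable_mul_of_summable_norm h1.norm h2.norm).hasSum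

theorem summable_pairRestr : Summable (pairRestr w F) :=
  summable_of_sym2 (hasSum_pairRestr_mk hw).summable

open scoped Classical in
theorem two_mul_tsum_pairRestr :
    2 * ∑' s, pairRestr w F s = ∑ p ∈ antidiagonal F,
      (total w p.1 * total w p.2 + if p.1 = p.2 then total (fun q => w q ^ 2) p.1 else 0) := by
  rw [two_mul_tsum_sym2 (hasSum_pairRestr_mk hw).summable, (hasSum_pairRestr_mk hw).tsum_eq,
    Finset.sum_add_distrib]
  congr 1
  simp only [pairRestr_diag]
  rw [Summable.tsum_finsetSum fun p hp => summable_restr_sq (hw p (Finset.mem_filter.1 hp).1).1,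
    Finset.sum_filter]
  rfl

open scoped Classical in
theorem hasSum_ite_isDiag_pairRestr :
    HasSum (fun s : Sym2 TreeClass => (if s.IsDiag then 1 / 2 else 1) * pairRestr w F s)
      ((∑ p ∈ antidiagonal F, total w p.1 * total w p.2) / 2) := by
  convert (hasSum_sym2 (hasSum_pairRestr_mk hw)).div_const 2 using 1
  funext s
  split_ifs
  · rw [one_nsmul, one_div, inv_mul_eq_div]
  · rw [nsmul_eq_mul, Nat.cast_ofNat, mul_div_cancel_left₀ _ two_ne_zero, one_mul]

end

theorem shape_binary_eq_pairShape (b : Bool) (s : Sym2 TreeClass) :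
    (binary b s).shape = if b then (pairShape s).withTop else pairShape s := by
  induction s with | _ q q'
  exact shape_binary

open scoped Classical in
/-- The total weight of the trees with a marked (`b = true`) or unmarked root whose other marked
vertices form a given poset. -/
noncomputable def body (w : TreeClass → 𝕜) (b : Bool) (G : Shape) : 𝕜 :=
  (if G = 0 then w (leaf b) else 0) +
    ((∑' q : TreeClass, if q.shape = G then w (unary b q) else 0) +
      ∑' s, if pairShape s = G then w (binary b s) else 0)

theorem tsum_eq_sum_ofRoot {f : TreeClass → 𝕜} (hsum : Summable f)
    (hf : ∀ q, f q ≠ 0 → q ∈ Set.range ofRoot) :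
    ∑' q, f q = ∑ b, (f (leaf b) + (∑' q, f (unary b q) + ∑' s, f (binary b s))) := by
  have hroot : Summable fun x => f (ofRoot x) := hsum.comp_injective ofRoot_injective
  rw [← ofRoot_injective.tsum_eq hf, hroot.tsum_prod, tsum_fintype]
  refine Finset.sum_congr rfl fun b _ => ?_
  have hb : Summable fun x => f (ofRoot (b, x)) := hroot.prod_factor b
  have hinr : Summable fun x => f (ofRoot (b, .inr x)) := hb.comp_injective Sum.inr_injective
  rw [Summable.tsum_sum (hb.comp_injective Sum.inl_injective) hinr,
    Summable.tsum_sum (hinr.comp_injective Sum.inl_injective)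
      (hinr.comp_injective Sum.inr_injective)]
  congr 1
  exact tsum_eq_single () fun u hu => absurd rfl hu

theorem total_eq_sum_ofRoot {w : TreeClass → 𝕜} {F : Shape} (hsum : Summable (restr w F))
    (hw : ∀ q, w q ≠ 0 → q ∈ Set.range ofRoot) :
    total w F = ∑ b, (restr w F (leaf b) +
      (∑' q, restr w F (unary b q) + ∑' s, restr w F (binary b s))) :=
  tsum_eq_sum_ofRoot hsum fun q hq => hw q fun h => hq (by rw [restr, h, ite_self])

theorem total_withTop {w : TreeClass → 𝕜} {G : Shape} (hsum : Summable (restr w G.withTop))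
    (hw : ∀ q, w q ≠ 0 → q ∈ Set.range ofRoot) :
    total w G.withTop = body w true G + body w false G.withTop := by
  classical
  rw [total_eq_sum_ofRoot hsum hw, Fintype.sum_bool]
  simp [body, restr, shape_leaf, shape_unary, shape_binary_eq_pairShape,
    Shape.withTop_injective.eq_iff, eq_comm (a := (0 : Shape))]

theorem total_of_forall_withTop_ne {w : TreeClass → 𝕜} {F : Shape} (hF : ∀ G, Shape.withTop G ≠ F)
    (hsum : Summable (restr w F)) (hw : ∀ q, w q ≠ 0 → q ∈ Set.range ofRoot) :
    total w F = body w false F := by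
  classical
  rw [total_eq_sum_ofRoot hsum hw, Fintype.sum_bool]
  simp [body, restr, shape_leaf, shape_unary, shape_binary_eq_pairShape, hF,
    eq_comm (a := (0 : Shape))]

/-! ### Generating functions of marked binary trees -/

section Weight

variable {𝕜 : Type*} [RCLike 𝕜] {z : 𝕜}

open scoped Classical in
/-- The weight `z ^ n` of a binary tree with `n` vertices. -/
noncomputable def binaryWeight (z : 𝕜) (q : TreeClass) : 𝕜 := if q.IsBinary then z ^ q.size else 0

theorem binaryWeight_sq (z : 𝕜) : (fun q => binaryWeight z q ^ 2) = binaryWeight (z ^ 2) := by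
  funext q
  simp only [binaryWeight, ite_pow, zero_pow two_ne_zero, pow_right_comm z]

theorem binaryWeight_leaf (b : Bool) : binaryWeight z (leaf b) = z := by
  rw [binaryWeight, if_pos isBinary_leaf, size_leaf, pow_one]

theorem binaryWeight_unary (b : Bool) (q : TreeClass) : binaryWeight z (unary b q) = 0 :=
  if_neg not_isBinary_unary

theorem binaryWeight_binary (b : Bool) (s : Sym2 TreeClass) :
    binaryWeight z (binary b s) = z * pairWeight (binaryWeight z) s := by
  classical
  induction s with | _ q q'
  change _ = z * (binaryWeight z q * binaryWeight z q')
  simp only [binaryWeight, isBinary_binary, size_binary, ite_zero_mul_ite_zero]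
  split_ifs <;> ring

theorem mem_range_ofRoot_of_binaryWeight_ne_zero {q : TreeClass} (h : binaryWeight z q ≠ 0) :
    q ∈ Set.range ofRoot :=
  IsBinary.mem_range_ofRoot (of_not_not fun hq => h (if_neg hq))

/-- The generating function, by the number of vertices, of the binary trees with marked vertices
forming a given poset. -/
noncomputable def gen (F : Shape) (z : 𝕜) : 𝕜 := total (binaryWeight z) F

theorem body_binaryWeight (b : Bool) (G : Shape) [Decidable (G = 0)] :
    body (binaryWeight z) b G =
      (if G = 0 then z else 0) + z * ∑' s, pairRestr (binaryWeight z) G s := by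
  simp only [body, binaryWeight_leaf, binaryWeight_unary, binaryWeight_binary, ite_self, tsum_zero,
    zero_add, ← tsum_mul_left, pairRestr, mul_ite, mul_zero]

theorem body_binaryWeight_zero (h : Summable (restr (binaryWeight z) 0)) (b : Bool) :
    body (binaryWeight z) b 0 = z + z / 2 * (gen 0 z ^ 2 + gen 0 (z ^ 2)) := by
  classical
  have hpair : 2 * ∑' s, pairRestr (binaryWeight z) 0 s = gen 0 z ^ 2 + gen 0 (z ^ 2) := by
    rw [two_mul_tsum_pairRestr (by simp [Shape.antidiagonal_zero, h]), Shape.antidiagonal_zero,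
      Finset.sum_singleton, if_pos rfl, binaryWeight_sq, sq (gen 0 z)]
    rfl
  rw [body_binaryWeight, if_pos rfl]
  linear_combination z / 2 * hpair

theorem gen_zero (h : Summable (restr (binaryWeight z) 0)) :
    gen 0 z = z + z / 2 * (gen 0 z ^ 2 + gen 0 (z ^ 2)) :=
  (total_of_forall_withTop_ne Shape.withTop_ne_zero h fun _ =>
    mem_range_ofRoot_of_binaryWeight_ne_zero).trans (body_binaryWeight_zero h false)

variable (hS : ∀ F : Shape, Summable (restr (binaryWeight z) F))
include hS

open scoped Classical in
theorem body_binaryWeight_of_ne_zero {F : Shape} (hF : F ≠ 0) (b : Bool) :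
    body (binaryWeight z) b F = z * gen 0 z * gen F z +
      z / 2 * ∑ p ∈ F.properAntidiagonal,
        (gen p.1 z * gen p.2 z + if p.1 = p.2 then gen p.1 (z ^ 2) else 0) := by
  have hpair := two_mul_tsum_pairRestr (w := binaryWeight z) (F := F) fun p _ => ⟨hS _, hS _⟩
  rw [Shape.sum_antidiagonal hF, if_neg hF.symm, if_neg hF, binaryWeight_sq] at hpair
  rw [body_binaryWeight, if_neg hF]
  simp only [gen]
  linear_combination z / 2 * hpair

open scoped Classical in
theorem gen_of_forall_withTop_ne {F : Shape} (hF : F ≠ 0) (h : ∀ G, Shape.withTop G ≠ F) :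
    gen F z * (1 - z * gen 0 z) = z / 2 * ∑ p ∈ F.properAntidiagonal,
        (gen p.1 z * gen p.2 z + if p.1 = p.2 then gen p.1 (z ^ 2) else 0) := by
  have hbody : gen F z = body (binaryWeight z) false F :=
    total_of_forall_withTop_ne h (hS F) fun _ => mem_range_ofRoot_of_binaryWeight_ne_zero
  rw [body_binaryWeight_of_ne_zero hS hF] at hbody
  linear_combination hbody

theorem gen_withTop (G : Shape) :
    gen G.withTop z * (1 - z * gen 0 z) = body (binaryWeight z) true G := by
  classical
  have hbody : gen G.withTop z =
      body (binaryWeight z) true G + body (binaryWeight z) false G.withTop :=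
    total_withTop (hS _) fun _ => mem_range_ofRoot_of_binaryWeight_ne_zero
  rw [body_binaryWeight_of_ne_zero hS G.withTop_ne_zero, Shape.properAntidiagonal_withTop,
    Finset.sum_empty] at hbody
  linear_combination hbody

theorem gen_withTop_zero : gen (Shape.withTop 0) z * (1 - z * gen 0 z) = gen 0 z := by
  rw [gen_withTop hS, body_binaryWeight_zero (hS 0), ← gen_zero (hS 0)]

theorem gen_withTop_withTop (G : Shape) :
    gen G.withTop.withTop z * (1 - z * gen 0 z) = z * gen 0 z * gen G.withTop z := by
  classical
  rw [gen_withTop hS, body_binaryWeight_of_ne_zero hS G.withTop_ne_zero,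
    Shape.properAntidiagonal_withTop, Finset.sum_empty, mul_zero, add_zero]

theorem gen_withTop_of_forall_withTop_ne {F : Shape} (hF : F ≠ 0) (h : ∀ G, Shape.withTop G ≠ F) :
    gen F.withTop z * (1 - z * gen 0 z) = gen F z := by
  classical
  rw [gen_withTop hS, body_binaryWeight_of_ne_zero hS hF, ← gen_of_forall_withTop_ne hS hF h]
  ring

end Weight

/-! ### Convergence -/

section Nonneg

variable {w w' : TreeClass → ℝ} {x y : ℝ} {F : Shape}

theorem restr_nonneg (hw : ∀ q, 0 ≤ w q) (F : Shape) (q : TreeClass) : 0 ≤ restr w F q := by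
  rw [restr]
  split_ifs
  exacts [hw q, le_rfl]

theorem restr_mono (hw : ∀ q, w q ≤ w' q) (F : Shape) (q : TreeClass) :
    restr w F q ≤ restr w' F q := by
  rw [restr, restr]
  split_ifs
  exacts [hw q, le_rfl]

theorem total_nonneg (hw : ∀ q, 0 ≤ w q) (F : Shape) : 0 ≤ total w F :=
  tsum_nonneg (restr_nonneg hw F)

theorem total_mono (hw : ∀ q, w q ≤ w' q) (h : Summable (restr w F)) (h' : Summable (restr w' F)) :
    total w F ≤ total w' F :=
  h.tsum_le_tsum (restr_mono hw F) h'

theorem binaryWeight_nonneg (hx : 0 ≤ x) (q : TreeClass) : 0 ≤ binaryWeight x q := by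
  rw [binaryWeight]
  split_ifs
  exacts [pow_nonneg hx _, le_rfl]

theorem binaryWeight_mono (hx : 0 ≤ x) (hxy : x ≤ y) (q : TreeClass) :
    binaryWeight x q ≤ binaryWeight y q := by
  rw [binaryWeight, binaryWeight]
  split_ifs
  exacts [pow_le_pow_left₀ hx hxy _, le_rfl]

theorem gen_nonneg (hx : 0 ≤ x) (F : Shape) : 0 ≤ gen F x :=
  total_nonneg (binaryWeight_nonneg hx) F

theorem summable_restr_mono (hx : 0 ≤ x) (hxy : x ≤ y) (h : Summable (restr (binaryWeight y) F)) :
    Summable (restr (binaryWeight x) F) :=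
  .of_nonneg_of_le (restr_nonneg (binaryWeight_nonneg hx) F)
    (restr_mono (binaryWeight_mono hx hxy) F) h

theorem gen_mono (hx : 0 ≤ x) (hxy : x ≤ y) (h : Summable (restr (binaryWeight y) F)) :
    gen F x ≤ gen F y :=
  total_mono (binaryWeight_mono hx hxy) (summable_restr_mono hx hxy h) h

end Nonneg

section Truncation

theorem finite_setOf_isBinary (N : ℕ) : {q : TreeClass | q.IsBinary ∧ q.size ≤ N}.Finite := by
  induction N with
  | zero => exact Set.finite_empty.subset fun q hq => (size_pos q).not_ge hq.2
  | succ N ih =>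
    refine ((Set.finite_range leaf).union ((Set.finite_univ.prod (ih.prod ih)).image
      fun x : Bool × TreeClass × TreeClass => binary x.1 s(x.2.1, x.2.2))).subset ?_
    rintro q ⟨h, hN⟩
    obtain ⟨⟨b, _ | q | s⟩, rfl⟩ := h.mem_range_ofRoot
    · exact .inl ⟨b, rfl⟩
    · exact absurd h not_isBinary_unary
    · induction s with | _ q q'
      change (binary b s(q, q')).size ≤ N + 1 at hN
      rw [size_binary] at hN
      have hbinary := isBinary_binary.1 h
      exact .inr ⟨(b, q, q'), ⟨trivial, ⟨hbinary.1, by lia⟩, ⟨hbinary.2, by lia⟩⟩, rfl⟩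

/-- The weight `z ^ n` of a binary tree with `n ≤ N` vertices. -/
noncomputable def truncWeight (N : ℕ) (x : ℝ) (q : TreeClass) : ℝ :=
  if q.size ≤ N then binaryWeight x q else 0

variable {x y : ℝ}

theorem truncWeight_sq (N : ℕ) (x : ℝ) :
    (fun q => truncWeight N x q ^ 2) = truncWeight N (x ^ 2) := by
  funext q
  simp only [truncWeight, ← binaryWeight_sq, ite_pow, zero_pow two_ne_zero]

theorem truncWeight_nonneg (N : ℕ) (hx : 0 ≤ x) (q : TreeClass) : 0 ≤ truncWeight N x q :=
  ite_nonneg (binaryWeight_nonneg hx q) le_rfl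

theorem truncWeight_le (N : ℕ) (hx : 0 ≤ x) (q : TreeClass) :
    truncWeight N x q ≤ binaryWeight x q := by
  rw [truncWeight]
  split_ifs
  exacts [le_rfl, binaryWeight_nonneg hx q]

theorem truncWeight_mono (N : ℕ) (hx : 0 ≤ x) (hxy : x ≤ y) (q : TreeClass) :
    truncWeight N x q ≤ truncWeight N y q := by
  rw [truncWeight, truncWeight]
  split_ifs
  exacts [binaryWeight_mono hx hxy q, le_rfl]

theorem summable_restr_truncWeight (N : ℕ) (x : ℝ) (F : Shape) :
    Summable (restr (truncWeight N x) F) := by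
  refine summable_of_hasFiniteSupport ((finite_setOf_isBinary N).subset fun q hq => ?_)
  simp only [restr, truncWeight, binaryWeight, Function.mem_support, ne_eq, ite_eq_right_iff,
    Classical.not_imp] at hq
  exact ⟨hq.2.2.1, hq.2.1⟩

theorem truncWeight_succ_leaf (N : ℕ) (b : Bool) : truncWeight (N + 1) x (leaf b) = x := by
  rw [truncWeight, size_leaf, if_pos (by lia), binaryWeight_leaf]

theorem truncWeight_unary (N : ℕ) (b : Bool) (q : TreeClass) : truncWeight N x (unary b q) = 0 := by
  rw [truncWeight, binaryWeight_unary, ite_self]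

theorem truncWeight_succ_binary_le (N : ℕ) (hx : 0 ≤ x) (b : Bool) (s : Sym2 TreeClass) :
    truncWeight (N + 1) x (binary b s) ≤ x * pairWeight (truncWeight N x) s := by
  induction s with | _ q q'
  change _ ≤ x * (truncWeight N x q * truncWeight N x q')
  rw [truncWeight, binaryWeight_binary, size_binary]
  split_ifs with h
  · rw [truncWeight, truncWeight, if_pos (by lia), if_pos (by lia)]
    rfl
  · exact mul_nonneg hx (mul_nonneg (truncWeight_nonneg N hx q) (truncWeight_nonneg N hx q'))

theorem total_truncWeight_zero (x : ℝ) (F : Shape) : total (truncWeight 0 x) F = 0 := by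
  simp [total, restr, truncWeight, (size_pos _).ne']

theorem body_truncWeight_succ_zero_le (N : ℕ) (hx : 0 ≤ x) (b : Bool) :
    body (truncWeight (N + 1) x) b 0 ≤ x + x * ∑' s, pairRestr (truncWeight N x) 0 s := by
  classical
  have hle (s) : (if pairShape s = 0 then truncWeight (N + 1) x (binary b s) else 0) ≤
      x * pairRestr (truncWeight N x) 0 s := by
    rw [pairRestr, mul_ite, mul_zero]
    split_ifs
    exacts [truncWeight_succ_binary_le N hx b s, le_rfl]
  have hsum : Summable fun s => x * pairRestr (truncWeight N x) 0 s :=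
    (summable_pairRestr fun _ _ =>
      ⟨summable_restr_truncWeight N x _, summable_restr_truncWeight N x _⟩).mul_left x
  simp only [body, truncWeight_succ_leaf, truncWeight_unary, ite_self, tsum_zero, zero_add,
    ← tsum_mul_left, if_true]
  refine add_le_add le_rfl (Summable.tsum_le_tsum hle ?_ hsum)
  exact (.of_nonneg_of_le (fun s => ite_nonneg (truncWeight_nonneg _ hx _) le_rfl) hle hsum)

theorem total_truncWeight_succ_zero_le (N : ℕ) (hx : 0 ≤ x) :
    total (truncWeight (N + 1) x) 0 ≤
      x + x / 2 * (total (truncWeight N x) 0 ^ 2 + total (truncWeight N (x ^ 2)) 0) := by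
  classical
  have hpair : 2 * ∑' s, pairRestr (truncWeight N x) 0 s =
      total (truncWeight N x) 0 ^ 2 + total (truncWeight N (x ^ 2)) 0 := by
    rw [two_mul_tsum_pairRestr fun _ _ => ⟨summable_restr_truncWeight N x _,
      summable_restr_truncWeight N x _⟩, Shape.antidiagonal_zero, Finset.sum_singleton,
      if_pos rfl, truncWeight_sq, sq (total _ _)]
  have hbody : total (truncWeight (N + 1) x) 0 = body (truncWeight (N + 1) x) false 0 :=
    total_of_forall_withTop_ne Shape.withTop_ne_zero (summable_restr_truncWeight _ x 0)
      fun q hq => mem_range_ofRoot_of_binaryWeight_ne_zero fun h =>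
        hq (by rw [truncWeight, h, ite_self])
  rw [hbody]
  refine (body_truncWeight_succ_zero_le N hx false).trans_eq ?_
  linear_combination x / 2 * hpair

theorem summable_of_total_truncWeight_le {c : ℝ} {F : Shape} (hx : 0 ≤ x)
    (h : ∀ N, total (truncWeight N x) F ≤ c) :
    Summable (restr (binaryWeight x) F) ∧ gen F x ≤ c := by
  have hle (u : Finset TreeClass) : ∑ q ∈ u, restr (binaryWeight x) F q ≤ c := by
    refine le_trans ?_ (h (u.sup size))
    refine le_trans (Finset.sum_le_sum fun q hq => ?_)
      ((summable_restr_truncWeight (u.sup size) x F).sum_le_tsum u fun q _ =>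
        restr_nonneg (truncWeight_nonneg _ hx) F q)
    simp only [restr, truncWeight, if_pos (Finset.le_sup (f := size) hq)]
    rfl
  have hnonneg := restr_nonneg (binaryWeight_nonneg hx) F
  exact ⟨summable_of_sum_le hnonneg hle, Real.tsum_le_of_sum_le hnonneg hle⟩

theorem total_truncWeight_half_le (N : ℕ) : total (truncWeight N (1 / 2)) 0 ≤ 1 := by
  induction N with
  | zero => exact (total_truncWeight_zero _ _).trans_le zero_le_one
  | succ N ih =>
    have hnonneg := total_nonneg (truncWeight_nonneg N (x := 1 / 2) (by norm_num)) 0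
    have hsq := total_mono (truncWeight_mono N (x := (1 / 2) ^ 2) (y := 1 / 2) (by norm_num)
      (by norm_num)) (summable_restr_truncWeight N _ 0) (summable_restr_truncWeight N _ 0)
    refine (total_truncWeight_succ_zero_le N (by norm_num)).trans ?_
    nlinarith

theorem summable_and_gen_le_one_half :
    Summable (restr (binaryWeight (1 / 2 : ℝ)) 0) ∧ gen 0 (1 / 2 : ℝ) ≤ 1 :=
  summable_of_total_truncWeight_le (by norm_num) total_truncWeight_half_le

theorem summable_of_supersolution (hx : 0 ≤ x) (hy : 0 ≤ y)
    (hsq : Summable (restr (binaryWeight (x ^ 2)) 0))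
    (h : x + x / 2 * (y ^ 2 + gen 0 (x ^ 2)) ≤ y) :
    Summable (restr (binaryWeight x) 0) ∧ gen 0 x ≤ y := by
  refine summable_of_total_truncWeight_le hx fun N => ?_
  induction N with
  | zero => exact (total_truncWeight_zero x 0).trans_le hy
  | succ N ih =>
    have hnonneg := total_nonneg (truncWeight_nonneg N hx) 0
    have htrunc : total (truncWeight N (x ^ 2)) 0 ≤ gen 0 (x ^ 2) :=
      total_mono (truncWeight_le N (sq_nonneg x)) (summable_restr_truncWeight N _ 0) hsq
    refine (total_truncWeight_succ_zero_le N hx).trans (le_trans ?_ h)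
    gcongr

end Truncation

section Marking

/-- The tree underlying a class of marked trees, with another set of marked vertices. -/
noncomputable def mark (u : TreeClass) (E : Finset (Quotient.out u).tree.Vertex) : TreeClass :=
  mk ⟨(Quotient.out u).tree, E⟩

variable (u : TreeClass) (E : Finset (Quotient.out u).tree.Vertex)

theorem size_mark : (mark u E).size = u.size :=
  (congrArg size (mk_out u) :)

theorem isBinary_mark : (mark u E).IsBinary ↔ u.IsBinary :=
  iff_of_eq (congrArg IsBinary (mk_out u) :)

theorem card_shape_mark : (mark u E).shape.card = E.card :=
  (Nat.card_coe_set_eq _).trans (Set.ncard_coe_finset E)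

theorem exists_eq_mark (q : TreeClass) : ∃ u E, u.shape = 0 ∧ mark u E = q := by
  obtain ⟨t, rfl⟩ := q.exists_eq_mk
  let u := mk ⟨t.tree, ∅⟩
  obtain ⟨φ, -⟩ : MarkedIso (Quotient.out u).original ∅ := mk_eq_mk.1 (mk_out u)
  let E := (Set.toFinite (φ ⁻¹' t.original)).toFinset
  refine ⟨u, E, Shape.of_eq_zero_iff.2 inferInstance, mk_eq_mk.2 ⟨φ, fun x => ?_⟩⟩
  simp [E]

theorem card_vertex_out : Nat.card (Quotient.out u).tree.Vertex = u.size :=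
  (congrArg size (mk_out u) :)

open scoped Classical in
/- The sum over the sets of vertices of `u` is a binomial expansion of `y ^ u.size`. -/
theorem summable_sigma_finset {x y : ℝ} (hx : 0 ≤ x) (hxy : x ≤ y)
    (hy : Summable (restr (binaryWeight y) 0)) :
    Summable fun p : Σ u : TreeClass, Finset (Quotient.out u).tree.Vertex =>
      if p.1.shape = 0 ∧ p.1.IsBinary then
        (y - x) ^ p.2.card * x ^ (p.1.size - p.2.card) else 0 := by
  have := sub_nonneg.2 hxy
  have (u : TreeClass) : Fintype (Quotient.out u).tree.Vertex := Fintype.ofFinite _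
  refine (summable_sigma_of_nonneg fun p => ?_).2
    ⟨fun u => (hasSum_fintype _).summable, hy.congr fun u => ?_⟩
  · positivity
  · rw [tsum_fintype, restr, binaryWeight]
    by_cases h0 : u.shape = 0
    · by_cases hb : u.IsBinary
      · simp only [h0, hb, and_self, if_true]
        have h := Fintype.sum_pow_mul_eq_add_pow (Quotient.out u).tree.Vertex (y - x) x
        rw [← Nat.card_eq_fintype_card, card_vertex_out, sub_add_cancel] at h
        exact h.symm
      · simp [hb]
    · simp [h0]

theorem summable_of_lt {x y : ℝ} (hx : 0 ≤ x) (hxy : x < y)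
    (hy : Summable (restr (binaryWeight y) 0)) (F : Shape) :
    Summable (restr (binaryWeight x) F) := by
  classical
  have hyx := sub_pos.2 hxy
  have (u : TreeClass) : Fintype (Quotient.out u).tree.Vertex := Fintype.ofFinite _
  choose u E hu hE using exists_eq_mark
  have hinj : Function.Injective
      fun q => (⟨u q, E q⟩ : Σ u : TreeClass, Finset (Quotient.out u).tree.Vertex) :=
    Function.LeftInverse.injective
      (g := fun p : Σ u : TreeClass, Finset (Quotient.out u).tree.Vertex => mark p.1 p.2) hE
  refine .of_nonneg_of_le (restr_nonneg (binaryWeight_nonneg hx) F) (fun q => ?_)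
    (((summable_sigma_finset hx hxy.le hy).comp_injective hinj).mul_left
      ((x / (y - x)) ^ F.card))
  have hsize : (u q).size = q.size := by rw [← size_mark (u q) (E q), hE]
  have hbinary : (u q).IsBinary ↔ q.IsBinary := by rw [← isBinary_mark (u q) (E q), hE]
  simp only [Function.comp_apply, hu, hbinary, hsize, true_and]
  rw [restr, binaryWeight]
  split_ifs with hF
  · have hcard : (E q).card = F.card := by rw [← card_shape_mark (u q) (E q), hE, hF]
    have hle : F.card ≤ q.size := by
      rw [← hcard, ← hsize, ← card_vertex_out]
      exact (E q).card_le_univ.trans_eq Nat.card_eq_fintype_card.symm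
    rw [hcard, div_pow, ← mul_assoc, div_mul_cancel₀ _ (pow_pos hyx _).ne', ← pow_add,
      Nat.add_sub_cancel' hle]
  all_goals positivity

end Marking

/-! ### Sums over binarizations -/

open scoped Classical in
/-- The weight `(1 / 2) ^ s` of a binarization with `s` symmetry nodes. -/
noncomputable def symmetryWeight (q : TreeClass) : ℝ :=
  if q.IsBinarization then (1 / 2) ^ q.symmetry else 0

theorem symmetryWeight_nonneg (q : TreeClass) : 0 ≤ symmetryWeight q := by
  rw [symmetryWeight]
  positivity

theorem symmetryWeight_leaf (b : Bool) : symmetryWeight (leaf b) = if b then 1 else 0 := by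
  simp [symmetryWeight, isBinarization_leaf, symmetry_leaf]

open scoped Classical in
theorem symmetryWeight_unary (b : Bool) (q : TreeClass) :
    symmetryWeight (unary b q) = if b = true ∧ q.shape.tops = 1 then symmetryWeight q else 0 := by
  simp only [symmetryWeight, isBinarization_unary, symmetry_unary, ← and_assoc, ite_and]

open scoped Classical in
theorem symmetryWeight_binary (b : Bool) (s : Sym2 TreeClass) :
    symmetryWeight (binary b s) = if b = true → 2 ≤ (pairShape s).tops then
      (if s.IsDiag then 1 / 2 else 1) * pairWeight symmetryWeight s else 0 := by
  induction s with | _ q q'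
  change _ = if b = true → 2 ≤ (q.shape + q'.shape).tops then
    (if s(q, q').IsDiag then 1 / 2 else 1) * (symmetryWeight q * symmetryWeight q') else 0
  simp only [symmetryWeight, isBinarization_binary, symmetry_binary, mul_ite,
    mul_zero, ite_and, Sym2.mk_isDiag_iff]
  split_ifs <;> ring

theorem finite_setOf_isBinarization (N : ℕ) :
    {q : TreeClass | q.IsBinarization ∧ q.shape.card ≤ N}.Finite := by
  induction N with
  | zero =>
    exact Set.finite_empty.subset fun q hq => (Shape.card_pos hq.1.shape_ne_zero).not_ge hq.2
  | succ N ih =>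
    refine ((Set.finite_range leaf).union ((ih.image (unary true)).union
      ((Set.finite_univ.prod (ih.prod ih)).image
        fun x : Bool × TreeClass × TreeClass => binary x.1 s(x.2.1, x.2.2)))).subset ?_
    rintro q ⟨h, hN⟩
    obtain ⟨⟨b, _ | q | s⟩, rfl⟩ := h.mem_range_ofRoot
    · exact .inl ⟨b, rfl⟩
    · obtain ⟨rfl, -, hq⟩ := isBinarization_unary.1 h
      change (unary true q).shape.card ≤ N + 1 at hN
      rw [shape_unary, if_pos rfl, Shape.card_withTop] at hN
      exact .inr (.inl ⟨q, ⟨hq, by lia⟩, rfl⟩)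
    · induction s with | _ q q'
      obtain ⟨-, hq, hq'⟩ := isBinarization_binary.1 h
      have hle : (q.shape + q'.shape).card ≤ N + 1 := by
        refine le_trans ?_ (show (binary b s(q, q')).shape.card ≤ N + 1 from hN)
        rw [shape_binary]
        split_ifs
        exacts [(Nat.le_succ _).trans_eq (Shape.card_withTop _).symm, le_rfl]
      have hpos := Shape.card_pos hq.shape_ne_zero
      have hpos' := Shape.card_pos hq'.shape_ne_zero
      rw [Shape.card_add] at hle
      exact .inr (.inr ⟨(b, q, q'), ⟨trivial, ⟨hq, by lia⟩, ⟨hq', by lia⟩⟩, rfl⟩)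

theorem summable_restr_symmetryWeight (F : Shape) : Summable (restr symmetryWeight F) := by
  refine summable_of_hasFiniteSupport ((finite_setOf_isBinarization F.card).subset fun q hq => ?_)
  simp only [restr, symmetryWeight, Function.mem_support, ne_eq, ite_eq_right_iff,
    Classical.not_imp] at hq
  exact ⟨hq.2.1, (congrArg Shape.card hq.1).le⟩

theorem mem_range_ofRoot_of_symmetryWeight_ne_zero {q : TreeClass} (h : symmetryWeight q ≠ 0) :
    q ∈ Set.range ofRoot :=
  IsBinarization.mem_range_ofRoot (of_not_not fun hq => h (if_neg hq))

/-- The sum of `(1 / 2) ^ s` over the binarizations of a poset, where `s` is the number of symmetry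
nodes. For the poset of a rooted tree `S` this is the constant `C_S`. -/
noncomputable def symmetrySum (F : Shape) : ℝ := total symmetryWeight F

theorem symmetrySum_nonneg (F : Shape) : 0 ≤ symmetrySum F := total_nonneg symmetryWeight_nonneg F

theorem symmetrySum_zero : symmetrySum 0 = 0 := by
  refine (tsum_congr fun q => ?_).trans tsum_zero
  rw [restr, symmetryWeight, ← ite_and]
  exact if_neg fun h => h.2.shape_ne_zero h.1

/-- The part of `symmetrySum F` coming from the binarizations whose root is an auxiliary vertex. -/
noncomputable def symmetryProd (F : Shape) : ℝ :=
  (∑ p ∈ antidiagonal F, symmetrySum p.1 * symmetrySum p.2) / 2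

open scoped Classical in
theorem hasSum_symmetryProd (F : Shape) :
    HasSum (fun s : Sym2 TreeClass => (if s.IsDiag then 1 / 2 else 1) *
      pairRestr symmetryWeight F s) (symmetryProd F) :=
  hasSum_ite_isDiag_pairRestr fun _ _ =>
    ⟨summable_restr_symmetryWeight _, summable_restr_symmetryWeight _⟩

theorem symmetryProd_eq {F : Shape} (hF : F ≠ 0) :
    symmetryProd F = (∑ p ∈ F.properAntidiagonal, symmetrySum p.1 * symmetrySum p.2) / 2 := by
  classical
  rw [symmetryProd, Shape.sum_antidiagonal hF]
  simp [symmetrySum_zero]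

theorem symmetryProd_of_tops_lt {F : Shape} (h : F.tops < 2) : symmetryProd F = 0 := by
  rw [symmetryProd, Finset.sum_eq_zero, zero_div]
  rintro ⟨G, H⟩ hp
  obtain rfl := mem_antidiagonal.1 hp
  rw [Shape.tops_add] at h
  obtain rfl | hG := eq_or_ne G 0
  · rw [symmetrySum_zero, zero_mul]
  obtain rfl | hH := eq_or_ne H 0
  · rw [symmetrySum_zero, mul_zero]
  have hpos := Shape.tops_pos hG
  have hpos' := Shape.tops_pos hH
  lia

theorem symmetryProd_withTop (F : Shape) : symmetryProd F.withTop = 0 :=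
  symmetryProd_of_tops_lt (by rw [Shape.tops_withTop]; exact one_lt_two)

theorem body_symmetryWeight_false (F : Shape) : body symmetryWeight false F = symmetryProd F := by
  classical
  rw [← (hasSum_symmetryProd F).tsum_eq]
  simp [body, symmetryWeight_leaf, symmetryWeight_unary, symmetryWeight_binary, pairRestr]

open scoped Classical in
theorem body_symmetryWeight_true (F : Shape) : body symmetryWeight true F =
    (if F = 0 then 1 else 0) + ((if F.tops = 1 then symmetrySum F else 0) + symmetryProd F) := by
  rw [body, symmetryWeight_leaf, if_pos rfl]
  congr 2
  · split_ifs with h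
    · refine tsum_congr fun q => ?_
      rw [symmetryWeight_unary, restr]
      exact ite_congr rfl (fun hq => if_pos ⟨rfl, hq ▸ h⟩) fun _ => rfl
    · refine (tsum_congr fun q => ?_).trans tsum_zero
      rw [symmetryWeight_unary, ← ite_and]
      refine if_neg ?_
      rintro ⟨rfl, -, htops⟩
      exact h htops
  · obtain h | h := lt_or_ge F.tops 2
    · rw [symmetryProd_of_tops_lt h]
      refine (tsum_congr fun s => ?_).trans tsum_zero
      rw [symmetryWeight_binary, ← ite_and]
      refine if_neg fun hs => ?_
      obtain ⟨rfl, hs⟩ := hs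
      exact h.not_ge (hs rfl)
    · rw [← (hasSum_symmetryProd F).tsum_eq]
      refine tsum_congr fun s => ?_
      rw [symmetryWeight_binary, pairRestr, mul_ite, mul_zero]
      refine ite_congr rfl (fun hs => ?_) fun _ => rfl
      exact if_pos fun _ => hs ▸ h

theorem symmetrySum_of_forall_withTop_ne {F : Shape} (h : ∀ G, Shape.withTop G ≠ F) :
    symmetrySum F = symmetryProd F :=
  (total_of_forall_withTop_ne h (summable_restr_symmetryWeight F) fun _ =>
    mem_range_ofRoot_of_symmetryWeight_ne_zero).trans (body_symmetryWeight_false F)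

theorem symmetrySum_withTop_eq_body (G : Shape) :
    symmetrySum G.withTop = body symmetryWeight true G := by
  rw [symmetrySum, total_withTop (summable_restr_symmetryWeight _) fun _ =>
    mem_range_ofRoot_of_symmetryWeight_ne_zero, body_symmetryWeight_false, symmetryProd_withTop,
    add_zero]

theorem symmetrySum_withTop_zero : symmetrySum (Shape.withTop 0) = 1 := by
  classical
  rw [symmetrySum_withTop_eq_body, body_symmetryWeight_true, if_pos rfl, Shape.tops_zero,
    if_neg zero_ne_one, symmetryProd_of_tops_lt (Shape.tops_zero.trans_lt two_pos), add_zero,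
    add_zero]

theorem symmetrySum_withTop {F : Shape} (hF : F ≠ 0) : symmetrySum F.withTop = symmetrySum F := by
  classical
  rw [symmetrySum_withTop_eq_body, body_symmetryWeight_true, if_neg hF, zero_add]
  split_ifs with h
  · rw [symmetryProd_of_tops_lt (by lia), add_zero]
  · rw [zero_add, symmetrySum_of_forall_withTop_ne]
    rintro G rfl
    exact h (Shape.tops_withTop G)

theorem symmetryProd_le (F : Shape) : symmetryProd F ≤ symmetrySum F := by
  by_cases h : ∃ G, Shape.withTop G = F
  · obtain ⟨G, rfl⟩ := h
    exact (symmetryProd_withTop G).trans_le (symmetrySum_nonneg _)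
  · exact (symmetrySum_of_forall_withTop_ne (not_exists.1 h)).ge

theorem symmetrySum_add_pos {F G : Shape} (hF : 0 < symmetrySum F) (hG : 0 < symmetrySum G) :
    0 < symmetrySum (F + G) := by
  refine (div_pos ((mul_pos hF hG).trans_le ?_) two_pos).trans_le (symmetryProd_le _)
  exact Finset.single_le_sum (f := fun p : Shape × Shape => symmetrySum p.1 * symmetrySum p.2)
    (fun _ _ => mul_nonneg (symmetrySum_nonneg _) (symmetrySum_nonneg _))
    (mem_antidiagonal.2 (rfl : (F, G).1 + (F, G).2 = F + G))

theorem symmetrySum_vertex_pos : (S : FinRootedTree) → 0 < symmetrySum (Shape.of S.Vertex)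
  | .node k child => by
    change 0 < symmetrySum (Shape.of (Σ i, (child i).Vertex)).withTop
    rw [Shape.of_sigma_fin]
    obtain hk | hk := (Finset.univ : Finset (Fin k)).eq_empty_or_nonempty
    · rw [hk, Finset.sum_empty, symmetrySum_withTop_zero]
      exact one_pos
    · have hpos : 0 < symmetrySum (∑ i, Shape.of (child i).Vertex) :=
        Finset.sum_induction_nonempty _ (fun F => 0 < symmetrySum F)
          (fun _ _ => symmetrySum_add_pos) hk fun i _ => symmetrySum_vertex_pos (child i)
      rwa [symmetrySum_withTop]
      intro h
      exact hpos.ne' (h ▸ symmetrySum_zero)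

open scoped ComplexConjugate

/-! ### The functional equation and its radius of convergence -/

section Complex

variable {F : Shape}

theorem norm_restr_binaryWeight (z : ℂ) (F : Shape) (q : TreeClass) :
    ‖restr (binaryWeight z) F q‖ = restr (binaryWeight ‖z‖) F q := by
  simp only [restr, binaryWeight]
  split_ifs <;> simp

theorem ofReal_restr_binaryWeight (x : ℝ) (F : Shape) (q : TreeClass) :
    ((restr (binaryWeight x) F q : ℝ) : ℂ) = restr (binaryWeight (x : ℂ)) F q := by
  simp only [restr, binaryWeight]
  split_ifs <;> simp

theorem ofReal_gen (F : Shape) (x : ℝ) : ((gen F x : ℝ) : ℂ) = gen F (x : ℂ) := by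
  simp only [gen, total, Complex.ofReal_tsum, ofReal_restr_binaryWeight]

theorem conj_gen (F : Shape) (z : ℂ) : conj (gen F z) = gen F (conj z) := by
  rw [gen, total, Complex.conj_tsum]
  refine tsum_congr fun q => ?_
  simp only [restr, binaryWeight]
  split_ifs <;> simp

theorem summable_restr_of_norm {z : ℂ} (h : Summable (restr (binaryWeight ‖z‖) F)) :
    Summable (restr (binaryWeight z) F) :=
  .of_norm (h.congr fun q => (norm_restr_binaryWeight z F q).symm)

theorem norm_gen_le {z : ℂ} (h : Summable (restr (binaryWeight ‖z‖) F)) :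
    ‖gen F z‖ ≤ gen F ‖z‖ :=
  tsum_of_norm_bounded h.hasSum fun q => (norm_restr_binaryWeight z F q).le

theorem differentiable_restr_binaryWeight (F : Shape) (q : TreeClass) :
    Differentiable ℂ fun z : ℂ => restr (binaryWeight z) F q := by
  simp only [restr, binaryWeight]
  split_ifs <;> fun_prop

theorem differentiableOn_gen {r : ℝ}
    (h : ∀ x : ℝ, 0 ≤ x → x < r → Summable (restr (binaryWeight x) F)) :
    DifferentiableOn ℂ (gen F) (Metric.ball (0 : ℂ) r) := by
  intro z hz
  obtain ⟨s, hzs, hsr⟩ := exists_between (mem_ball_zero_iff.1 hz)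
  have hsum := h s ((norm_nonneg z).trans hzs.le) hsr
  have hdiff : DifferentiableOn ℂ (gen F) (Metric.ball (0 : ℂ) s) :=
    Complex.differentiableOn_tsum_of_summable_norm hsum
      (fun q => (differentiable_restr_binaryWeight F q).differentiableOn) Metric.isOpen_ball
      fun q w hw => (norm_restr_binaryWeight w F q).trans_le
        (restr_mono (binaryWeight_mono (norm_nonneg w) (mem_ball_zero_iff.1 hw).le) F q)
  exact (hdiff.differentiableAt
    (Metric.isOpen_ball.mem_nhds (mem_ball_zero_iff.2 hzs))).differentiableWithinAt

end Complex

section Half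

variable {x y : ℝ}

theorem summable_zero_of_le_half (hx : 0 ≤ x) (hx' : x ≤ 1 / 2) :
    Summable (restr (binaryWeight x) 0) :=
  summable_restr_mono hx hx' summable_and_gen_le_one_half.1

theorem gen_zero_le_one (hx : 0 ≤ x) (hx' : x ≤ 1 / 2) : gen 0 x ≤ 1 :=
  (gen_mono hx hx' summable_and_gen_le_one_half.1).trans summable_and_gen_le_one_half.2

theorem le_gen_zero (hx : 0 ≤ x) (h : Summable (restr (binaryWeight x) 0)) : x ≤ gen 0 x := by
  have hsq := gen_nonneg (sq_nonneg x) 0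
  rw [gen_zero h]
  exact le_add_of_nonneg_right (by positivity)

theorem gen_zero_le_two_mul (hx : 0 ≤ x) (hx' : x ≤ 1 / 2) : gen 0 x ≤ 2 * x := by
  have hle := gen_zero_le_one hx hx'
  have hle' := gen_zero_le_one (sq_nonneg x) (by nlinarith)
  have hnonneg := gen_nonneg hx 0
  calc gen 0 x = x + x / 2 * (gen 0 x ^ 2 + gen 0 (x ^ 2)) :=
        gen_zero (summable_zero_of_le_half hx hx')
    _ ≤ x + x / 2 * (1 ^ 2 + 1) := by gcongr
    _ = 2 * x := by ring

end Half

section Discriminant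

/-- The function `δ` such that `δ (z ^ 2)` is the discriminant of the quadratic equation
`V = z + z / 2 * (V ^ 2 + V (z ^ 2))` in `V`. -/
noncomputable def discr {𝕜 : Type*} [RCLike 𝕜] (z : 𝕜) : 𝕜 := 1 - (2 * z + z * gen 0 z)

theorem one_sub_mul_gen_sq {𝕜 : Type*} [RCLike 𝕜] {z : 𝕜}
    (h : Summable (restr (binaryWeight z) 0)) : (1 - z * gen 0 z) ^ 2 = discr (z ^ 2) := by
  rw [discr]
  linear_combination (-2 * z) * gen_zero h

theorem ofReal_discr (x : ℝ) : ((discr x : ℝ) : ℂ) = discr (x : ℂ) := by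
  simp [discr, ofReal_gen]

theorem conj_discr (z : ℂ) : conj (discr z) = discr (conj z) := by
  simp [discr, conj_gen, Complex.conj_ofNat]

variable {x y : ℝ}

theorem discr_le (hx : 0 ≤ x) (hxy : x ≤ y) (hy : y ≤ 1 / 2) :
    discr y ≤ discr x - 2 * (y - x) := by
  have hmono := mul_le_mul hxy (gen_mono hx hxy (summable_zero_of_le_half (hx.trans hxy) hy))
    (gen_nonneg hx 0) (hx.trans hxy)
  rw [discr, discr]
  linarith

theorem discr_le_one (hx : 0 ≤ x) : discr x ≤ 1 := by
  have := gen_nonneg hx 0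
  rw [discr]
  exact sub_le_self _ (by positivity)

theorem differentiableOn_discr : DifferentiableOn ℂ (discr : ℂ → ℂ) (Metric.ball 0 (1 / 2)) := by
  have := differentiableOn_gen (r := 1 / 2) fun x hx hx' => summable_zero_of_le_half hx hx'.le
  unfold discr
  fun_prop

theorem analyticAt_discr {z : ℂ} (hz : ‖z‖ < 1 / 2) : AnalyticAt ℂ (discr : ℂ → ℂ) z :=
  differentiableOn_discr.analyticAt (Metric.isOpen_ball.mem_nhds (mem_ball_zero_iff.2 hz))

theorem continuousOn_discr : ContinuousOn (discr : ℝ → ℝ) (Set.Icc 0 (1 / 2)) := by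
  have : ContinuousOn (gen 0 : ℝ → ℝ) (Set.Icc 0 (1 / 2)) := by
    refine continuousOn_tsum (fun q => ?_) summable_and_gen_le_one_half.1 fun q x hx => ?_
    · simp only [restr, binaryWeight]
      split_ifs <;> fun_prop
    · rw [Real.norm_of_nonneg (restr_nonneg (binaryWeight_nonneg hx.1) 0 q)]
      exact restr_mono (binaryWeight_mono hx.1 hx.2) 0 q
  unfold discr
  fun_prop

theorem exists_discr_eq_zero : ∃ x : ℝ, 0 < x ∧ x < 1 / 2 ∧ discr x = 0 := by
  have hzero : discr (0 : ℝ) = 1 := by simp [discr]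
  have hhalf : discr (1 / 2 : ℝ) < 0 := by
    have := le_gen_zero (by norm_num) summable_and_gen_le_one_half.1
    rw [discr]
    linarith
  obtain ⟨x, ⟨hx, hx'⟩, hx0⟩ := intermediate_value_Icc' (by norm_num) continuousOn_discr
    ⟨hhalf.le, zero_le_one.trans_eq hzero.symm⟩
  refine ⟨x, hx.lt_of_ne ?_, hx'.lt_of_ne ?_, hx0⟩
  · rintro rfl
    exact one_ne_zero (hzero.symm.trans hx0)
  · rintro rfl
    exact hhalf.ne hx0

end Discriminant

section Root

theorem mul_root_pow_four {x₀ : ℝ} (h0 : 0 ≤ x₀) (h1 : x₀ ≤ 1 / 2) (hd : discr x₀ = 0) :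
    38 * x₀ ^ 4 + x₀ ^ 4 * gen 0 (x₀ ^ 4) = 1 := by
  have hsq := one_sub_mul_gen_sq (summable_zero_of_le_half h0 h1)
  have hfour := one_sub_mul_gen_sq (summable_zero_of_le_half (sq_nonneg x₀) (by nlinarith))
  rw [← pow_mul, show 2 * 2 = 4 from rfl] at hfour
  rw [discr] at hd hsq hfour
  have hmul : x₀ * gen 0 x₀ = 1 - 2 * x₀ := by linarith
  rw [hmul] at hsq
  have hmul_sq : x₀ ^ 2 * gen 0 (x₀ ^ 2) = 1 - 6 * x₀ ^ 2 := by linarith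
  rw [hmul_sq] at hfour
  linear_combination hfour

theorem bounds_of_mul_add_mul_gen_eq_one {y : ℝ} (hy : 0 ≤ y) (h : 38 * y + y * gen 0 y = 1) :
    0.02629 < y ∧ y ≤ 1 / 38 := by
  have hnonneg := gen_nonneg hy 0
  have hy' : y ≤ 1 / 38 := by nlinarith
  refine ⟨?_, hy'⟩
  by_contra! hlt
  have hy2 := gen_zero_le_two_mul (sq_nonneg y) (by nlinarith)
  have hy1 := gen_zero_le_two_mul hy (by linarith)
  have hgen : gen 0 y ≤ 0.0264 := by
    calc gen 0 y = y + y / 2 * (gen 0 y ^ 2 + gen 0 (y ^ 2)) :=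
          gen_zero (summable_zero_of_le_half hy (by linarith))
      _ ≤ y + y / 2 * ((2 * y) ^ 2 + 2 * y ^ 2) := by gcongr
      _ ≤ 0.02629 + 0.02629 / 2 * ((2 * 0.02629) ^ 2 + 2 * 0.02629 ^ 2) := by gcongr
      _ ≤ 0.0264 := by norm_num
  have hmul : y * gen 0 y ≤ 0.02629 * 0.0264 := by gcongr
  linarith

theorem abs_root_sub_lt {ρ : ℝ} (h0 : 0 ≤ ρ) (h1 : ρ ^ 2 ≤ 1 / 2) (hd : discr (ρ ^ 2) = 0) :
    |ρ - 0.6346| < 0.00005 := by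
  obtain ⟨hlt, hle⟩ :=
    bounds_of_mul_add_mul_gen_eq_one (by positivity) (mul_root_pow_four (sq_nonneg ρ) h1 hd)
  rw [← pow_mul] at hlt hle
  have hlower : 0.63455 < ρ := lt_of_pow_lt_pow_left₀ 8 h0 (lt_of_le_of_lt (by norm_num) hlt)
  have hupper : ρ < 0.63465 :=
    lt_of_pow_lt_pow_left₀ 8 (by norm_num) (lt_of_le_of_lt hle (by norm_num))
  rw [abs_lt]
  constructor <;> linarith

theorem summable_and_gen_zero_le {x : ℝ} (hx : 0 < x) (hx' : x ^ 2 ≤ 1 / 2)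
    (hd : 0 ≤ discr (x ^ 2)) :
    Summable (restr (binaryWeight x) 0) ∧ gen 0 x ≤ (1 - √(discr (x ^ 2))) / x := by
  have hsqrt : √(discr (x ^ 2)) ≤ 1 := Real.sqrt_le_one.2 (discr_le_one (sq_nonneg x))
  refine summable_of_supersolution hx.le (div_nonneg (sub_nonneg.2 hsqrt) hx.le)
    (summable_zero_of_le_half (sq_nonneg x) hx') (le_of_eq ?_)
  have hroot := Real.sq_sqrt hd
  nth_rw 2 [discr] at hroot
  field_simp
  linear_combination hroot

section

variable {x ρ : ℝ} (hx : 0 ≤ x) (hx' : x < ρ) (h1 : ρ ^ 2 ≤ 1 / 2) (hd : discr (ρ ^ 2) = 0)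
include hx hx' h1 hd

theorem discr_sq_pos_of_lt_root : 0 < discr (x ^ 2) := by
  have hlt : x ^ 2 < ρ ^ 2 := by gcongr
  have := discr_le (sq_nonneg x) hlt.le h1
  linarith

theorem summable_of_lt_root (F : Shape) : Summable (restr (binaryWeight x) F) := by
  obtain ⟨y, hxy, hy⟩ := exists_between hx'
  have hy0 : 0 < y := hx.trans_lt hxy
  have hy2 : y ^ 2 ≤ 1 / 2 := le_trans (by gcongr) h1
  exact summable_of_lt hx hxy (summable_and_gen_zero_le hy0 hy2
    (discr_sq_pos_of_lt_root hy0.le hy h1 hd).le).1 F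

theorem mul_gen_zero_lt_one : x * gen 0 x < 1 := by
  obtain rfl | hx0 := hx.eq_or_lt
  · simp
  have hx2 : x ^ 2 ≤ 1 / 2 := le_trans (by gcongr) h1
  have hpos := discr_sq_pos_of_lt_root hx hx' h1 hd
  have hle := (summable_and_gen_zero_le hx0 hx2 hpos.le).2
  rw [le_div_iff₀ hx0] at hle
  linarith [Real.sqrt_pos.2 hpos]

end

end Root

section Discriminant

variable {x₀ : ℝ} {z : ℂ}

theorem deriv_discr_ne_zero (h0 : 0 < x₀) (h1 : x₀ < 1 / 2) :
    deriv (discr : ℂ → ℂ) x₀ ≠ 0 := by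
  have han : AnalyticAt ℂ (discr : ℂ → ℂ) x₀ :=
    analyticAt_discr (by rwa [Complex.norm_real, Real.norm_of_nonneg h0.le])
  have hderiv : HasDerivAt (discr : ℝ → ℝ) (deriv (discr : ℂ → ℂ) x₀).re x₀ := by
    simpa only [← ofReal_discr, Complex.ofReal_re] using
      han.differentiableAt.hasDerivAt.real_of_complex
  have hslope : ∀ᶠ t in 𝓝[<] x₀, slope discr x₀ t ≤ -2 := by
    filter_upwards [Ioo_mem_nhdsLT h0] with t ht
    rw [slope_comm, slope_def_field, div_le_iff₀ (sub_pos.2 ht.2)]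
    linarith [discr_le ht.1.le ht.2.le h1.le]
  have hle : (deriv (discr : ℂ → ℂ) x₀).re ≤ -2 :=
    le_of_tendsto ((hasDerivAt_iff_tendsto_slope.1 hderiv).mono_left
      (nhdsLT_le_nhdsNE x₀)) hslope
  intro h
  norm_num [h] at hle

theorem re_lt_of_norm_le_of_ne (hz : ‖z‖ ≤ x₀) (hz' : z ≠ x₀) : z.re < x₀ := by
  refine ((Complex.re_le_norm z).trans hz).lt_of_ne fun h => hz' ?_
  have hnorm : z.re = ‖z‖ := le_antisymm (Complex.re_le_norm z) (hz.trans_eq h.symm)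
  exact (Complex.eq_coe_norm_of_nonneg (Complex.re_eq_norm.1 hnorm)).trans (by rw [← hnorm, h])

theorem re_discr_pos (h1 : x₀ ≤ 1 / 2) (hd : discr x₀ = 0) (hz : ‖z‖ ≤ x₀) (hz' : z ≠ x₀) :
    0 < (discr z).re := by
  have hre := re_lt_of_norm_le_of_ne hz hz'
  have hx₀ : 0 ≤ x₀ := (norm_nonneg z).trans hz
  have hsum := summable_zero_of_le_half (norm_nonneg z) (hz.trans h1)
  have hmul : (z * gen 0 z).re ≤ x₀ * gen 0 x₀ := by
    calc (z * gen 0 z).re ≤ ‖z‖ * ‖gen 0 z‖ := (Complex.re_le_norm _).trans_eq (norm_mul _ _)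
      _ ≤ x₀ * gen 0 x₀ := by
        gcongr
        exact (norm_gen_le hsum).trans
          (gen_mono (norm_nonneg z) hz (summable_zero_of_le_half hx₀ h1))
  have hre_discr : (discr z).re = 1 - (2 * z.re + (z * gen 0 z).re) := by simp [discr]
  rw [hre_discr]
  rw [discr] at hd
  linarith

section Root

variable (h0 : 0 < x₀) (h1 : x₀ < 1 / 2) (hd : discr x₀ = 0)
include h0 h1 hd

-- `discr` is injective near `x₀` and commutes with conjugation, so a real value of `discr` is taken
-- at a real point only.
theorem eventually_discr_mem_slitPlane :
    ∀ᶠ z : ℂ in 𝓝 (x₀ : ℂ), ¬ (z.im = 0 ∧ x₀ ≤ z.re) → discr z ∈ Complex.slitPlane := by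
  have han : AnalyticAt ℂ (discr : ℂ → ℂ) x₀ :=
    analyticAt_discr (by rwa [Complex.norm_real, Real.norm_of_nonneg h0.le])
  have hinv := han.hasStrictDerivAt.eventually_left_inverse (deriv_discr_ne_zero h0 h1)
  have hconj : Filter.Tendsto conj (𝓝 (x₀ : ℂ)) (𝓝 (x₀ : ℂ)) := by
    simpa using Complex.continuous_conj.tendsto (x₀ : ℂ)
  have hre : ∀ᶠ z : ℂ in 𝓝 (x₀ : ℂ), 0 < z.re :=
    Complex.continuous_re.continuousAt.eventually (lt_mem_nhds (by simpa using h0))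
  filter_upwards [hinv, hconj.eventually hinv, hre] with z hz hz' hzre hns
  by_contra hslit
  rw [Complex.mem_slitPlane_iff, not_or, not_lt, not_not] at hslit
  rw [← conj_discr, Complex.conj_eq_iff_im.2 hslit.2, hz] at hz'
  obtain ⟨x, rfl⟩ := Complex.conj_eq_iff_real.1 hz'.symm
  rw [← ofReal_discr] at hslit
  simp only [Complex.ofReal_re, Complex.ofReal_im, true_and, not_le] at hslit hzre hns
  linarith [discr_le hzre.le hns.le h1.le, hslit.1]

theorem exists_radius_discr_mem_slitPlane : ∃ r : ℝ, x₀ < r ∧ r ≤ 1 / 2 ∧ ∀ z : ℂ, ‖z‖ < r →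
    ¬ (z.im = 0 ∧ x₀ ≤ z.re) → discr z ∈ Complex.slitPlane := by
  have hsub : Metric.closedBall (0 : ℂ) x₀ ⊆
      interior {z : ℂ | ¬ (z.im = 0 ∧ x₀ ≤ z.re) → discr z ∈ Complex.slitPlane} := by
    intro z hz
    rw [mem_interior_iff_mem_nhds]
    rw [mem_closedBall_zero_iff] at hz
    obtain rfl | hzx := eq_or_ne z x₀
    · exact eventually_discr_mem_slitPlane h0 h1 hd
    · have hslit : discr z ∈ Complex.slitPlane := .inl (re_discr_pos h1.le hd hz hzx)
      filter_upwards [(analyticAt_discr (hz.trans_lt h1)).continuousAt.eventually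
        (Complex.isOpen_slitPlane.mem_nhds hslit)] with w hw _ using hw
  obtain ⟨ε, hε, h⟩ := (isCompact_closedBall (0 : ℂ) x₀).exists_thickening_subset_open
    isOpen_interior hsub
  rw [thickening_closedBall hε h0.le] at h
  refine ⟨min (ε + x₀) (1 / 2), lt_min (by linarith) h1, min_le_right _ _, fun z hz => ?_⟩
  exact interior_subset (h (mem_ball_zero_iff.2 (hz.trans_le (min_le_left _ _))))

end Root

end Discriminant

/-- Radii `ρ < R` such that `discr (ρ ^ 2) = 0` and `discr (z ^ 2)` avoids the branch cut of the
square root for `z` in `slitDisc ρ R`: then `ρ` is the radius of convergence of `gen F` for every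
`F`, and the quadratic equation of `gen 0` can be solved in `slitDisc ρ R`. -/
structure IsSingularRadius (ρ R : ℝ) : Prop where
  pos : 0 < ρ
  lt : ρ < R
  sq_le_half : R ^ 2 ≤ 1 / 2
  discr_sq : discr (ρ ^ 2) = 0
  discr_sq_mem_slitPlane : ∀ z ∈ slitDisc ρ R, discr (z ^ 2) ∈ Complex.slitPlane

theorem le_abs_re_of_le_re_sq {ρ : ℝ} (hρ : 0 < ρ) {z : ℂ} (him : (z ^ 2).im = 0)
    (hre : ρ ^ 2 ≤ (z ^ 2).re) : z.im = 0 ∧ ρ ≤ |z.re| := by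
  simp only [sq z, Complex.mul_im, Complex.mul_re] at him hre
  have hz : z.im = 0 := by
    by_contra hne
    have : z.re = 0 := by
      refine (mul_eq_zero.1 (?_ : z.re * z.im = 0)).resolve_right hne
      linarith
    rw [this] at hre
    nlinarith [mul_self_nonneg z.im]
  rw [hz] at hre
  exact ⟨hz, (sq_le_sq₀ hρ.le (abs_nonneg _)).1 (by simpa [sq] using hre)⟩

theorem exists_isSingularRadius : ∃ ρ R : ℝ, IsSingularRadius ρ R := by
  obtain ⟨x₀, h0, h1, hd⟩ := exists_discr_eq_zero
  obtain ⟨r, hr, hr', hslit⟩ := exists_radius_discr_mem_slitPlane h0 h1 hd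
  have hρ := Real.sqrt_pos.2 h0
  have hρsq : √x₀ ^ 2 = x₀ := Real.sq_sqrt h0.le
  have hRsq : √r ^ 2 = r := Real.sq_sqrt (h0.trans hr).le
  refine ⟨√x₀, √r, hρ, Real.sqrt_lt_sqrt h0.le hr, hRsq.trans_le hr', by rwa [hρsq],
    fun z ⟨hz, hz'⟩ => hslit _ ?_ fun ⟨him, hre⟩ => ?_⟩
  · rw [norm_pow, ← hRsq]
    gcongr
  · exact hz' (le_abs_re_of_le_re_sq hρ him (hρsq.trans_le hre))

end TreeClass

/-! ### Analytic continuation -/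

section SlitDisc

variable {ρ R : ℝ} {z w : ℂ}

theorem mem_slitDisc_of_norm_lt (h : ρ < R) (hz : ‖z‖ < ρ) : z ∈ slitDisc ρ R :=
  ⟨hz.trans h, fun hn => ((Complex.abs_re_le_norm z).trans_lt hz).not_ge hn.2⟩

theorem norm_eq_of_sq_eq (h0 : 0 < ρ) (hw : w ^ 2 = (ρ : ℂ) ^ 2) : ‖w‖ = ρ := by
  rcases sq_eq_sq_iff_eq_or_eq_neg.1 hw with rfl | rfl <;> simp [abs_of_pos h0]

theorem notMem_slitDisc_of_sq_eq (hw : w ^ 2 = (ρ : ℂ) ^ 2) : w ∉ slitDisc ρ R := by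
  refine fun h => h.2 ?_
  rcases sq_eq_sq_iff_eq_or_eq_neg.1 hw with rfl | rfl <;> simp [le_abs_self]

theorem neBot_nhdsWithin_slitDisc (h0 : 0 < ρ) (h : ρ < R) (hw : w ^ 2 = (ρ : ℂ) ^ 2) :
    (𝓝[slitDisc ρ R] w).NeBot := by
  refine neBot_of_le (nhdsWithin_mono w (s := Metric.ball 0 ρ) fun z hz =>
    mem_slitDisc_of_norm_lt h (mem_ball_zero_iff.1 hz)) (hf := ?_)
  rw [← mem_closure_iff_nhdsWithin_neBot, closure_ball (0 : ℂ) h0.ne']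
  simp [norm_eq_of_sq_eq h0 hw]

end SlitDisc

theorem not_analyticAt_of_sq_eventuallyEq {D g : ℂ → ℂ} {w : ℂ} {l : Filter ℂ} [l.NeBot]
    (hl : l ≤ 𝓝[≠] w) (hD : AnalyticAt ℂ D w) (h0 : D w = 0) (hd : deriv D w ≠ 0)
    (h : (fun z => g z ^ 2) =ᶠ[l] D) : ¬AnalyticAt ℂ g w := by
  intro hg
  have hsq : (fun z => g z ^ 2) =ᶠ[𝓝 w] D :=
    ((hg.pow 2).frequently_eq_iff_eventually_eq hD).1 (h.frequently.filter_mono hl)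
  have hg0 : g w = 0 := pow_eq_zero_iff two_ne_zero |>.1 (hsq.eq_of_nhds.trans h0)
  refine hd (hsq.deriv_eq.symm.trans ((hg.differentiableAt.hasDerivAt.fun_pow 2).deriv.trans ?_))
  simp [hg0]

namespace TreeClass

/-- The solution `V` of `(1 - z * V) ^ 2 = discr (z ^ 2)` with `1 - z * V` in the right half-plane,
which continues `gen 0` beyond its disc of convergence. Division by zero gives the right value
`gen 0 0 = 0` at `0`. -/
noncomputable def continuedGen (z : ℂ) : ℂ := (1 - (discr (z ^ 2)).sqrt) / z

theorem one_sub_mul_continuedGen (z : ℂ) : 1 - z * continuedGen z = (discr (z ^ 2)).sqrt := by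
  obtain rfl | hz := eq_or_ne z 0
  · simp [discr]
  · rw [continuedGen, mul_div_cancel₀ _ hz, sub_sub_cancel]

theorem one_sub_mul_continuedGen_sq (z : ℂ) : (1 - z * continuedGen z) ^ 2 = discr (z ^ 2) := by
  rw [one_sub_mul_continuedGen, Complex.sqrt, Complex.cpow_ofNat_inv_pow]

theorem continuedGen_eq_gen {z : ℂ} (hS : Summable (restr (binaryWeight ‖z‖) 0))
    (hlt : ‖z‖ * gen 0 ‖z‖ < 1) : continuedGen z = gen 0 z := by
  have hz := summable_restr_of_norm hS
  obtain rfl | hz0 := eq_or_ne z 0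
  · rw [gen_zero hz, continuedGen, div_zero, zero_div, zero_mul, zero_add]
  have hre : 0 < (1 - z * gen 0 z).re := by
    have : (z * gen 0 z).re ≤ ‖z‖ * gen 0 ‖z‖ :=
      calc (z * gen 0 z).re ≤ ‖z‖ * ‖gen 0 z‖ := (Complex.re_le_norm _).trans_eq (norm_mul _ _)
        _ ≤ ‖z‖ * gen 0 ‖z‖ := by gcongr; exact norm_gen_le hS
    rw [Complex.sub_re, Complex.one_re]
    linarith
  rw [continuedGen, ← one_sub_mul_gen_sq hz, Complex.sqrt, Complex.sq_cpow_two_inv hre,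
    sub_sub_cancel, mul_div_cancel_left₀ _ hz0]

namespace IsSingularRadius

variable {ρ R : ℝ} (h : IsSingularRadius ρ R) {z w : ℂ}
include h

theorem root_sq_le_half : ρ ^ 2 ≤ 1 / 2 :=
  (pow_le_pow_left₀ h.pos.le h.lt.le 2).trans h.sq_le_half

theorem abs_sub_lt : |ρ - 0.6346| < 0.00005 :=
  abs_root_sub_lt h.pos.le h.root_sq_le_half h.discr_sq

theorem norm_sq_lt (hz : ‖z‖ ≤ R) : ‖z ^ 2‖ < ρ := by
  rw [norm_pow]
  calc ‖z‖ ^ 2 ≤ R ^ 2 := by gcongr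
    _ ≤ 1 / 2 := h.sq_le_half
    _ < ρ := by linarith [(abs_lt.1 h.abs_sub_lt).1]

theorem summable_norm (hz : ‖z‖ < ρ) (F : Shape) : Summable (restr (binaryWeight ‖z‖) F) :=
  summable_of_lt_root (norm_nonneg z) hz h.root_sq_le_half h.discr_sq F

theorem summable (hz : ‖z‖ < ρ) (F : Shape) : Summable (restr (binaryWeight z) F) :=
  summable_restr_of_norm (h.summable_norm hz F)

theorem continuedGen_eq_gen (hz : ‖z‖ < ρ) : continuedGen z = gen 0 z :=
  TreeClass.continuedGen_eq_gen (h.summable_norm hz 0)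
    (mul_gen_zero_lt_one (norm_nonneg z) hz h.root_sq_le_half h.discr_sq)

theorem differentiableAt_gen (hz : ‖z‖ < ρ) (F : Shape) : DifferentiableAt ℂ (gen F) z :=
  (differentiableOn_gen fun _ hx hx' => summable_of_lt_root hx hx' h.root_sq_le_half h.discr_sq F)
    |>.differentiableAt (Metric.isOpen_ball.mem_nhds (mem_ball_zero_iff.2 hz))

theorem differentiableAt_gen_sq (hz : ‖z‖ ≤ R) (F : Shape) :
    DifferentiableAt ℂ (fun z : ℂ => gen F (z ^ 2)) z :=
  (h.differentiableAt_gen (h.norm_sq_lt hz) F).comp z (differentiableAt_pow 2)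

theorem norm_sq_lt_half (hz : ‖z‖ < R) : ‖z ^ 2‖ < 1 / 2 := by
  rw [norm_pow]
  exact lt_of_lt_of_le (by gcongr) h.sq_le_half

theorem analyticAt_discr_sq (hz : ‖z‖ < R) : AnalyticAt ℂ (fun z : ℂ => discr (z ^ 2)) z :=
  (analyticAt_discr (h.norm_sq_lt_half hz)).fun_comp (f := fun z : ℂ => z ^ 2) (analyticAt_id.pow 2)

theorem one_sub_ne_zero (hz : z ∈ slitDisc ρ R) : 1 - z * continuedGen z ≠ 0 := by
  rw [← pow_ne_zero_iff two_ne_zero, one_sub_mul_continuedGen_sq]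
  exact Complex.slitPlane_ne_zero (h.discr_sq_mem_slitPlane z hz)

theorem one_sub_gen_ne_zero (hz : ‖z‖ < ρ) : 1 - z * gen 0 z ≠ 0 :=
  h.continuedGen_eq_gen hz ▸ h.one_sub_ne_zero (mem_slitDisc_of_norm_lt h.lt hz)

theorem differentiableOn_continuedGen : DifferentiableOn ℂ continuedGen (slitDisc ρ R) := by
  intro z hz
  obtain rfl | hz0 := eq_or_ne z 0
  · have hball : Metric.ball (0 : ℂ) ρ ∈ 𝓝 0 := Metric.ball_mem_nhds 0 h.pos
    have hgen : continuedGen =ᶠ[𝓝 0] gen 0 := by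
      filter_upwards [hball] with w hw using h.continuedGen_eq_gen (mem_ball_zero_iff.1 hw)
    exact (hgen.differentiableAt_iff.2
      (h.differentiableAt_gen (by simpa using h.pos) 0)).differentiableWithinAt
  · have hsqrt := (Complex.differentiableAt_sqrt (h.discr_sq_mem_slitPlane z hz)).comp z
      (h.analyticAt_discr_sq hz.1).differentiableAt
    exact ((hsqrt.const_sub 1).div differentiableAt_id hz0).differentiableWithinAt

theorem differentiableOn_one_sub :
    DifferentiableOn ℂ (fun z => 1 - z * continuedGen z) (slitDisc ρ R) :=
  (differentiableOn_id.mul h.differentiableOn_continuedGen).const_sub 1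

section Singularity

variable (hw : w ^ 2 = (ρ : ℂ) ^ 2)
include hw

theorem ne_zero : w ≠ 0 := by
  rw [← norm_pos_iff, norm_eq_of_sq_eq h.pos hw]
  exact h.pos

theorem norm_lt : ‖w‖ < R := (norm_eq_of_sq_eq h.pos hw).trans_lt h.lt

theorem discr_sq_eq_zero : discr (w ^ 2) = 0 := by
  rw [hw, ← Complex.ofReal_pow, ← ofReal_discr, h.discr_sq, Complex.ofReal_zero]

theorem continuousAt_continuedGen : ContinuousAt continuedGen w := by
  have hsqrt : ContinuousAt (fun z : ℂ => (discr (z ^ 2)).sqrt) w :=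
    (Complex.continuousAt_sqrt (.inl (by simp [h.discr_sq_eq_zero hw]))).comp
      (f := fun z : ℂ => discr (z ^ 2)) (h.analyticAt_discr_sq (h.norm_lt hw)).continuousAt
  exact (continuousAt_const.sub hsqrt).div continuousAt_id (h.ne_zero hw)

theorem continuedGen_eq_inv : continuedGen w = w⁻¹ := by
  rw [continuedGen, h.discr_sq_eq_zero hw, Complex.sqrt_zero, sub_zero, one_div]

theorem tendsto_continuedGen : Tendsto continuedGen (𝓝[slitDisc ρ R] w) (𝓝 w⁻¹) :=
  h.continuedGen_eq_inv hw ▸ (h.continuousAt_continuedGen hw).tendsto.mono_left nhdsWithin_le_nhds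

theorem tendsto_mul_continuedGen :
    Tendsto (fun z => z * continuedGen z) (𝓝[slitDisc ρ R] w) (𝓝 1) := by
  rw [← mul_inv_cancel₀ (h.ne_zero hw)]
  exact (tendsto_id.mono_left nhdsWithin_le_nhds).mul (h.tendsto_continuedGen hw)

theorem tendsto_one_sub :
    Tendsto (fun z => 1 - z * continuedGen z) (𝓝[slitDisc ρ R] w) (𝓝 0) := by
  simpa using (h.tendsto_mul_continuedGen hw).const_sub 1

theorem deriv_discr_sq_ne_zero : deriv (fun z : ℂ => discr (z ^ 2)) w ≠ 0 := by
  have hne : deriv (discr : ℂ → ℂ) (w ^ 2) ≠ 0 := by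
    rw [hw, ← Complex.ofReal_pow]
    exact deriv_discr_ne_zero (pow_pos h.pos 2)
      (lt_of_lt_of_le (pow_lt_pow_left₀ h.lt h.pos.le two_ne_zero) h.sq_le_half)
  have hderiv := (analyticAt_discr
    (h.norm_sq_lt_half (h.norm_lt hw))).differentiableAt.hasDerivAt.comp w (hasDerivAt_pow 2 w)
  rw [show deriv (fun z : ℂ => discr (z ^ 2)) w = _ from hderiv.deriv]
  simp [hne, h.ne_zero hw]

theorem not_exists_analyticAt_continuedGen :
    ¬∃ g : ℂ → ℂ, AnalyticAt ℂ g w ∧ continuedGen =ᶠ[𝓝[slitDisc ρ R] w] g := by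
  rintro ⟨g, hg, hVg⟩
  have := neBot_nhdsWithin_slitDisc h.pos h.lt hw
  refine not_analyticAt_of_sq_eventuallyEq (g := fun z => 1 - z * g z) (l := 𝓝[slitDisc ρ R] w)
    (nhdsWithin_mono w fun z hz hzw => notMem_slitDisc_of_sq_eq hw (hzw ▸ hz))
    (h.analyticAt_discr_sq (h.norm_lt hw)) (h.discr_sq_eq_zero hw) (h.deriv_discr_sq_ne_zero hw)
    ?_ (analyticAt_const.sub (analyticAt_id.mul hg))
  filter_upwards [hVg] with z hz
  rw [← hz, one_sub_mul_continuedGen_sq]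

end Singularity

end IsSingularRadius

/-- `A` is analytic on `slitDisc ρ R` and continues `gen F`, and at the points `w` with
`w ^ 2 = ρ ^ 2` it is asymptotic to `symmetrySum F / w` times a power of `1 / (1 - z * V z)`, with
`V = continuedGen`. -/
structure IsContinuation (ρ R : ℝ) (F : Shape) (A : ℂ → ℂ) : Prop where
  eq_gen : ∀ z : ℂ, ‖z‖ < ρ → A z = gen F z
  differentiableOn : DifferentiableOn ℂ A (slitDisc ρ R)
  tendsto : ∀ w : ℂ, w ^ 2 = (ρ : ℂ) ^ 2 →
    Tendsto (fun z => A z * (1 - z * continuedGen z) ^ (F.card + F.leaves - 1))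
      (𝓝[slitDisc ρ R] w) (𝓝 (symmetrySum F / w))

section Existence

variable {ρ R : ℝ} {F : Shape} {A B : ℂ → ℂ}

namespace IsSingularRadius

variable (h : IsSingularRadius ρ R)
include h

theorem isContinuation_div (hF : F ≠ 0)
    (hgen : ∀ z : ℂ, ‖z‖ < ρ → gen F z * (1 - z * gen 0 z) = B z)
    (hdiff : DifferentiableOn ℂ B (slitDisc ρ R))
    (htendsto : ∀ w : ℂ, w ^ 2 = (ρ : ℂ) ^ 2 →
      Tendsto (fun z => B z * (1 - z * continuedGen z) ^ (F.card + F.leaves - 2))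
        (𝓝[slitDisc ρ R] w) (𝓝 (symmetrySum F / w))) :
    IsContinuation ρ R F fun z => B z / (1 - z * continuedGen z) where
  eq_gen z hz := by
    rw [h.continuedGen_eq_gen hz, div_eq_iff (h.one_sub_gen_ne_zero hz), hgen z hz]
  differentiableOn := hdiff.div h.differentiableOn_one_sub fun _ => h.one_sub_ne_zero
  tendsto w hw := by
    refine (htendsto w hw).congr' ?_
    filter_upwards [self_mem_nhdsWithin] with z hz
    have hexp : F.card + F.leaves - 1 = F.card + F.leaves - 2 + 1 := by
      have := Shape.card_pos hF
      have := Shape.leaves_pos hF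
      lia
    rw [hexp, pow_succ', ← mul_assoc, div_mul_cancel₀ _ (h.one_sub_ne_zero hz)]

theorem isContinuation_withTop_zero :
    IsContinuation ρ R (Shape.withTop 0) fun z => continuedGen z / (1 - z * continuedGen z) := by
  refine h.isContinuation_div (Shape.withTop_ne_zero 0) (fun z hz => ?_)
    h.differentiableOn_continuedGen fun w hw => ?_
  · rw [gen_withTop_zero (h.summable hz), h.continuedGen_eq_gen hz]
  · simpa [Shape.card_withTop, Shape.card_zero, Shape.leaves_withTop_zero,
      symmetrySum_withTop_zero] using h.tendsto_continuedGen hw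

theorem isContinuation_withTop (hF : F ≠ 0) (hA : IsContinuation ρ R F A) {f : ℂ → ℂ}
    (hf : DifferentiableOn ℂ f (slitDisc ρ R))
    (htendsto : ∀ w : ℂ, w ^ 2 = (ρ : ℂ) ^ 2 → Tendsto f (𝓝[slitDisc ρ R] w) (𝓝 1))
    (hgen : ∀ z, ‖z‖ < ρ → gen F.withTop z * (1 - z * gen 0 z) = f z * gen F z) :
    IsContinuation ρ R F.withTop fun z => f z * A z / (1 - z * continuedGen z) := by
  refine h.isContinuation_div F.withTop_ne_zero (fun z hz => ?_) (hf.mul hA.differentiableOn)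
    fun w hw => ?_
  · rw [hgen z hz, hA.eq_gen z hz]
  · have hexp : F.withTop.card + F.withTop.leaves - 2 = F.card + F.leaves - 1 := by
      rw [Shape.card_withTop, Shape.leaves_withTop hF]
      lia
    rw [hexp, symmetrySum_withTop hF]
    simpa only [one_mul, mul_assoc] using (htendsto w hw).mul (hA.tendsto w hw)

theorem exists_isContinuation_withTop (hF : F ≠ 0) (hA : IsContinuation ρ R F A) :
    ∃ A', IsContinuation ρ R F.withTop A' := by
  by_cases hG : ∃ G, Shape.withTop G = F
  · obtain ⟨G, rfl⟩ := hG
    refine ⟨_, h.isContinuation_withTop hF hA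
      (differentiableOn_id.mul h.differentiableOn_continuedGen)
      (fun w hw => h.tendsto_mul_continuedGen hw) fun z hz => ?_⟩
    rw [gen_withTop_withTop (h.summable hz), ← h.continuedGen_eq_gen hz]
    rfl
  · refine ⟨_, h.isContinuation_withTop hF hA (differentiableOn_const 1)
      (fun _ _ => tendsto_const_nhds) fun z hz => ?_⟩
    rw [gen_withTop_of_forall_withTop_ne (h.summable hz) hF (not_exists.1 hG), one_mul]

theorem differentiableAt_ite_gen_sq (P : Prop) [Decidable P] {z : ℂ} (hz : ‖z‖ ≤ R) :
    DifferentiableAt ℂ (fun z : ℂ => if P then gen F (z ^ 2) else 0) z := by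
  split_ifs
  · exact h.differentiableAt_gen_sq hz F
  · exact differentiableAt_const 0

-- The two singular factors multiply to a pole of the full order, in which the analytic diagonal
-- term does not take part.
theorem tendsto_pair {G H : Shape} (hG : G ≠ 0) (hA : IsContinuation ρ R G A)
    (hB : IsContinuation ρ R H B) (hH : H ≠ 0) (P : Prop) [Decidable P] {w : ℂ}
    (hw : w ^ 2 = (ρ : ℂ) ^ 2) :
    Tendsto (fun z => (A z * B z + if P then gen G (z ^ 2) else 0) *
      (1 - z * continuedGen z) ^ ((G + H).card + (G + H).leaves - 2)) (𝓝[slitDisc ρ R] w)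
      (𝓝 (symmetrySum G / w * (symmetrySum H / w))) := by
  have hexp : (G + H).card + (G + H).leaves - 2 =
      (G.card + G.leaves - 1) + (H.card + H.leaves - 1) := by
    have := Shape.card_pos hG
    have := Shape.card_pos hH
    rw [Shape.card_add, Shape.leaves_add]
    lia
  have hexp_ne : (G + H).card + (G + H).leaves - 2 ≠ 0 := by
    have := Shape.card_pos hG
    have := Shape.leaves_pos hG
    have := Shape.card_pos hH
    rw [Shape.card_add, Shape.leaves_add]
    lia
  have hpow : Tendsto (fun z => (1 - z * continuedGen z) ^ ((G + H).card + (G + H).leaves - 2))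
      (𝓝[slitDisc ρ R] w) (𝓝 0) := by
    simpa [hexp_ne] using (h.tendsto_one_sub hw).pow ((G + H).card + (G + H).leaves - 2)
  have hdiag := ((h.differentiableAt_ite_gen_sq (F := G) P (h.norm_lt hw).le).continuousAt.tendsto
    |>.mono_left nhdsWithin_le_nhds).mul hpow
  have hlim := ((hA.tendsto w hw).mul (hB.tendsto w hw)).add hdiag
  rw [mul_zero, add_zero] at hlim
  refine hlim.congr fun z => ?_
  rw [add_mul, hexp, pow_add]
  ring

open scoped Classical in
theorem isContinuation_of_forall_withTop_ne (hF : F ≠ 0) (hF' : ∀ G, Shape.withTop G ≠ F)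
    {B : Shape → ℂ → ℂ}
    (hB : ∀ G : Shape, G ≠ 0 → G.card < F.card → IsContinuation ρ R G (B G)) :
    IsContinuation ρ R F fun z => z / 2 * (∑ p ∈ F.properAntidiagonal,
      (B p.1 z * B p.2 z + if p.1 = p.2 then gen p.1 (z ^ 2) else 0)) /
        (1 - z * continuedGen z) := by
  have hpair {p} (hp : p ∈ F.properAntidiagonal) :
      IsContinuation ρ R p.1 (B p.1) ∧ IsContinuation ρ R p.2 (B p.2) :=
    have hlt := Shape.card_lt_of_mem_properAntidiagonal hp
    have hne := (Shape.mem_properAntidiagonal.1 hp).2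
    ⟨hB _ hne.1 hlt.1, hB _ hne.2 hlt.2⟩
  refine h.isContinuation_div hF (fun z hz => ?_) (.mul (by fun_prop) (.fun_sum fun p hp => ?_))
    fun w hw => ?_
  · rw [gen_of_forall_withTop_ne (h.summable hz) hF hF']
    congr 1
    refine Finset.sum_congr rfl fun p hp => ?_
    rw [(hpair hp).1.eq_gen z hz, (hpair hp).2.eq_gen z hz]
  · exact ((hpair hp).1.differentiableOn.mul (hpair hp).2.differentiableOn).add fun z hz =>
      (h.differentiableAt_ite_gen_sq _ hz.1.le).differentiableWithinAt
  · have hterm (p) (hp : p ∈ F.properAntidiagonal) :=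
      have hmem := Shape.mem_properAntidiagonal.1 hp
      hmem.1 ▸ h.tendsto_pair hmem.2.1 (hpair hp).1 (hpair hp).2 hmem.2.2 (p.1 = p.2) hw
    have hlim : w / 2 * ∑ p ∈ F.properAntidiagonal,
        (symmetrySum p.1 : ℂ) / w * (symmetrySum p.2 / w) = symmetrySum F / w := by
      have hw0 := h.ne_zero hw
      rw [symmetrySum_of_forall_withTop_ne hF', symmetryProd_eq hF]
      push_cast
      rw [Finset.mul_sum, Finset.sum_div, Finset.sum_div]
      refine Finset.sum_congr rfl fun p _ => ?_
      field_simp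
    rw [← hlim]
    refine (((tendsto_id.mono_left nhdsWithin_le_nhds).div_const 2).mul
      (tendsto_finsetSum _ hterm)).congr fun z => ?_
    rw [← Finset.sum_mul, mul_assoc, id]

theorem exists_isContinuation (hF : F ≠ 0) : ∃ A, IsContinuation ρ R F A := by
  induction hn : F.card using Nat.strong_induction_on generalizing F with | _ n ih
  subst hn
  by_cases hF' : ∃ G, Shape.withTop G = F
  · obtain ⟨G, rfl⟩ := hF'
    obtain rfl | hG := eq_or_ne G 0
    · exact ⟨_, h.isContinuation_withTop_zero⟩
    · obtain ⟨A, hA⟩ := ih G.card (by rw [Shape.card_withTop]; lia) hG rfl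
      exact h.exists_isContinuation_withTop hG hA
  · have hB (G : Shape) : ∃ A, G ≠ 0 → G.card < F.card → IsContinuation ρ R G A := by
      by_cases hG : G ≠ 0 ∧ G.card < F.card
      · obtain ⟨A, hA⟩ := ih G.card hG.2 hG.1 rfl
        exact ⟨A, fun _ _ => hA⟩
      · exact ⟨0, fun hG0 hlt => absurd ⟨hG0, hlt⟩ hG⟩
    choose B hB using hB
    exact ⟨_, h.isContinuation_of_forall_withTop_ne hF (not_exists.1 hF') hB⟩

end IsSingularRadius

end Existence

namespace IsContinuation

variable {ρ R : ℝ} {F : Shape} {A : ℂ → ℂ} {w : ℂ}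
  (hA : IsContinuation ρ R F A) (h : IsSingularRadius ρ R) (hF : F ≠ 0) (hpos : 0 < symmetrySum F)
  (hw : w ^ 2 = (ρ : ℂ) ^ 2)
include hA h hF hpos hw

-- `A` tends to infinity at `w`.
theorem not_exists_analyticAt :
    ¬∃ g : ℂ → ℂ, AnalyticAt ℂ g w ∧ A =ᶠ[𝓝[slitDisc ρ R] w] g := by
  rintro ⟨g, hg, hAg⟩
  have := neBot_nhdsWithin_slitDisc h.pos h.lt hw
  have hexp : F.card + F.leaves - 1 ≠ 0 := by
    have := Shape.card_pos hF
    have := Shape.leaves_pos hF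
    lia
  have hzero := (hg.continuousAt.tendsto.mono_left nhdsWithin_le_nhds).mul
    ((h.tendsto_one_sub hw).pow (F.card + F.leaves - 1))
  rw [zero_pow hexp, mul_zero] at hzero
  have heq := tendsto_nhds_unique (hA.tendsto w hw)
    (hzero.congr' (hAg.mono fun z hz => by rw [← hz]))
  exact div_ne_zero (Complex.ofReal_ne_zero.2 hpos.ne') (h.ne_zero hw) heq

theorem isEquivalent (u : ℕ) :
    Asymptotics.IsEquivalent (𝓝[slitDisc ρ R] w) A fun z =>
      (1 / (1 - z * continuedGen z)) ^ (F.card + F.leaves - 1) * z ^ (F.leaves + u - 1) *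
        continuedGen z ^ (F.leaves + u) * (symmetrySum F : ℂ) := by
  have hw0 := h.ne_zero hw
  have hlim_ne : (symmetrySum F : ℂ) / w ≠ 0 :=
    div_ne_zero (Complex.ofReal_ne_zero.2 hpos.ne') hw0
  obtain ⟨k, hk⟩ : ∃ k, F.leaves + u = k + 1 :=
    Nat.exists_eq_add_one.2 (Nat.add_pos_left (Shape.leaves_pos hF) u)
  have hfactor : Tendsto (fun z => z ^ k * continuedGen z ^ (k + 1) * (symmetrySum F : ℂ))
      (𝓝[slitDisc ρ R] w) (𝓝 (symmetrySum F / w)) := by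
    have hlim : w ^ k * w⁻¹ ^ (k + 1) * (symmetrySum F : ℂ) = symmetrySum F / w := by
      rw [inv_pow]
      field_simp
      ring
    rw [← hlim]
    exact (((tendsto_id.mono_left nhdsWithin_le_nhds).pow k).mul
      ((h.tendsto_continuedGen hw).pow (k + 1))).mul_const _
  have hequiv := ((Asymptotics.isEquivalent_const_iff_tendsto hlim_ne).2 (hA.tendsto w hw)).trans
    ((Asymptotics.isEquivalent_const_iff_tendsto hlim_ne).2 hfactor).symm
  refine ((hequiv.mul (.refl (u := fun z =>
    (1 / (1 - z * continuedGen z)) ^ (F.card + F.leaves - 1)))).congr_left ?_).congr_right ?_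
  · filter_upwards [self_mem_nhdsWithin] with z hz
    have hne := pow_ne_zero (F.card + F.leaves - 1) (h.one_sub_ne_zero hz)
    simp only [Pi.mul_apply]
    rw [one_div, inv_pow, mul_inv_cancel_right₀ hne]
  · refine .of_forall fun z => ?_
    simp only [Pi.mul_apply]
    rw [hk, Nat.add_sub_cancel]
    ring

end IsContinuation

end TreeClass

/-! ### Counting by isomorphism classes -/

open TreeClass

namespace TreeClass

/-- The classes of the binary trees with `n` vertices whose marked vertices form a given poset. -/
def binaryTrees (F : Shape) (n : ℕ) : Set TreeClass :=
  {q | q.IsBinary ∧ q.shape = F ∧ q.size = n}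

theorem finite_binaryTrees (F : Shape) (n : ℕ) : (binaryTrees F n).Finite :=
  (finite_setOf_isBinary n).subset fun _ hq => ⟨hq.1, hq.2.2.le⟩

theorem hasSum_ncard_binaryTrees {z : ℂ} {F : Shape} (hS : Summable (restr (binaryWeight z) F)) :
    HasSum (fun n => ((binaryTrees F n).ncard : ℂ) * z ^ n) (gen F z) := by
  refine (hS.hasSum.tsum_fiberwise size).congr_fun fun n => ?_
  have hindicator : (size ⁻¹' {n}).indicator (restr (binaryWeight z) F) =
      (binaryTrees F n).indicator fun _ => z ^ n := by
    classical
    funext q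
    simp only [Set.indicator, restr, binaryWeight, binaryTrees, Set.mem_preimage,
      Set.mem_singleton_iff, Set.mem_ofPred_eq]
    split_ifs <;> simp_all
  rw [tsum_subtype, hindicator, ← tsum_subtype, tsum_const, Nat.card_coe_set_eq, nsmul_eq_mul]

end TreeClass

namespace NonplaneBinary

variable {n : ℕ} {T T' : NonplaneBinary n} {E : Set T.tree.Vertex} {E' : Set T'.tree.Vertex}

/-- The class of a non-plane binary tree with a set of marked vertices. -/
noncomputable def withMarks (T : NonplaneBinary n) (E : Set T.tree.Vertex) : TreeClass :=
  mk ⟨T.tree, E⟩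

theorem withMarks_mem_binaryTrees {F : Shape} (hE : Shape.of E = F) :
    T.withMarks E ∈ binaryTrees F n :=
  ⟨(Quotient.out T).2.1, hE, (Quotient.out T).2.2⟩

theorem eq_of_withMarks_eq (h : T.withMarks E = T'.withMarks E') : T = T' := by
  obtain ⟨φ, -⟩ := mk_eq_mk.1 h
  rw [← Quotient.out_eq T, ← Quotient.out_eq T']
  exact Quotient.sound ⟨φ⟩

theorem exists_eq_withMarks {q : TreeClass} (hq : q.IsBinary) (hn : q.size = n) :
    ∃ (T : NonplaneBinary n) (E : Set T.tree.Vertex), q = T.withMarks E := by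
  obtain ⟨⟨T, E⟩, rfl⟩ := q.exists_eq_mk
  let T' : NonplaneBinary n := Quotient.mk _ ⟨T, hq, hn⟩
  obtain ⟨φ⟩ : Nonempty (T'.tree.Vertex ≃o T.Vertex) :=
    Quotient.mk_out (s := binarySetoid n) ⟨T, hq, hn⟩
  exact ⟨T', φ ⁻¹' E, (mk_eq_mk.2 ⟨φ, fun _ => Iff.rfl⟩).symm⟩

theorem card_eq_ncard_binaryTrees (n : ℕ) :
    Nat.card (NonplaneBinary n) = (binaryTrees 0 n).ncard := by
  have hinj : Function.Injective fun T : NonplaneBinary n => T.withMarks ∅ :=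
    fun _ _ => eq_of_withMarks_eq
  have hrange : Set.range (fun T : NonplaneBinary n => T.withMarks ∅) = binaryTrees 0 n := by
    refine Set.Subset.antisymm (Set.range_subset_iff.2 fun T =>
      withMarks_mem_binaryTrees (Shape.of_eq_zero_iff.2 inferInstance)) fun q hq => ?_
    obtain ⟨T, E, rfl⟩ := exists_eq_withMarks hq.1 hq.2.2
    obtain rfl : E = ∅ := Set.isEmpty_coe_sort.1 (Shape.of_eq_zero_iff.1 hq.2.1)
    exact ⟨T, rfl⟩
  rw [← hrange, ← Nat.card_coe_set_eq, Nat.card_range_of_injective hinj]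

instance instFinite : Finite (NonplaneBinary n) := by
  have := (finite_binaryTrees 0 n).to_subtype
  exact Finite.of_injective (fun T : NonplaneBinary n => (⟨T.withMarks ∅,
    withMarks_mem_binaryTrees (Shape.of_eq_zero_iff.2 inferInstance)⟩ : binaryTrees 0 n))
    fun _ _ h => eq_of_withMarks_eq (congrArg Subtype.val h)

end NonplaneBinary

section TotalEmbeddings

variable (S : FinRootedTree) (n : ℕ)

variable {S n} in
/-- The class of a binary tree in which the vertices of an embedding of `S` are marked. -/
noncomputable def embeddingClass
    (x : Σ T : NonplaneBinary n, Quotient (embeddingSetoid S T.tree)) : TreeClass :=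
  Quotient.lift (s := embeddingSetoid S x.1.tree) (fun E => x.1.withMarks E.1) (fun _ _ ⟨φ, h⟩ =>
    mk_eq_mk.2 ⟨φ, (image_eq_iff_forall_mem φ).1 h⟩) x.2

theorem embeddingClass_injective : Function.Injective (embeddingClass (S := S) (n := n)) := by
  rintro ⟨T, e⟩ ⟨T', e'⟩ h
  obtain ⟨E, rfl⟩ := Quotient.exists_rep e
  obtain ⟨E', rfl⟩ := Quotient.exists_rep e'
  replace h : T.withMarks E.1 = T'.withMarks E'.1 := h
  obtain rfl := NonplaneBinary.eq_of_withMarks_eq h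
  obtain ⟨φ, hφ⟩ := mk_eq_mk.1 h
  exact congrArg (Sigma.mk T) (Quotient.sound ⟨φ, (image_eq_iff_forall_mem φ).2 hφ⟩)

theorem range_embeddingClass :
    Set.range (embeddingClass (S := S) (n := n)) = binaryTrees (Shape.of S.Vertex) n := by
  refine Set.Subset.antisymm (Set.range_subset_iff.2 ?_) fun q hq => ?_
  · rintro ⟨T, e⟩
    obtain ⟨E, rfl⟩ := Quotient.exists_rep e
    exact NonplaneBinary.withMarks_mem_binaryTrees (Shape.of_eq_of.2 E.2)
  · obtain ⟨T, E, rfl⟩ := NonplaneBinary.exists_eq_withMarks hq.1 hq.2.2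
    exact ⟨⟨T, Quotient.mk _ ⟨E, Shape.of_eq_of.1 hq.2.1⟩⟩, rfl⟩

theorem totalEmbeddings_eq_ncard_binaryTrees :
    S.totalEmbeddings n = (binaryTrees (Shape.of S.Vertex) n).ncard := by
  have := Fintype.ofFinite (NonplaneBinary n)
  rw [totalEmbeddings, finsum_eq_sum_of_fintype, ← range_embeddingClass, ← Nat.card_coe_set_eq,
    Nat.card_range_of_injective (embeddingClass_injective S n), Nat.card_sigma]
  rfl

end TotalEmbeddings

theorem shape_vertex_ne_zero (S : FinRootedTree) : Shape.of S.Vertex ≠ 0 := fun h =>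
  (Shape.of_eq_zero_iff.1 h).false ⊤

theorem tops_shape_vertex : (S : FinRootedTree) → (Shape.of S.Vertex).tops = 1
  | .node _ child => Shape.tops_withTop (Shape.of (Σ i, (child i).Vertex))

theorem isBinarization_mk {t : MarkedTree} : (mk t).IsBinarization ↔
    (∀ x ∉ t.original, outDegree x = 2) ∧
      ∀ x : t.original, outDegree (x : t.tree.Vertex) = min 2 (outDegree x) :=
  forall_and.trans (and_congr_right' ⟨fun h x => h x x.2, fun h x hx => h ⟨x, hx⟩⟩)

theorem top_mem_original {t : MarkedTree} (h : (mk t).IsBinarization)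
    (htops : (mk t).shape.tops = 1) : ⊤ ∈ t.original := by
  obtain ⟨b, k, c, rfl⟩ := t.exists_eq_node
  rcases b with _ | _
  swap
  · exact (top_mem_nodeSet (E := fun i => (c i).original)).2 rfl
  rw [← node_map_mk] at h htops
  obtain ⟨hcard, hbranch⟩ := isBinarization_node.1 h
  obtain ⟨q, q', hqq'⟩ := Multiset.card_eq_two.1 hcard
  rw [hqq'] at hbranch htops
  have hpos := Shape.tops_pos (hbranch q (by simp)).shape_ne_zero
  have hpos' := Shape.tops_pos (hbranch q' (by simp)).shape_ne_zero
  have hsum : q.shape.tops + q'.shape.tops = 1 := by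
    simpa [shape_node, Shape.tops_add] using htops
  lia

namespace Binarization

variable {S : FinRootedTree}

/-- The class of a binarization, in which the original vertices are marked. -/
noncomputable def toTreeClass (t : S.Binarization) : TreeClass := mk (Quotient.out t).1

theorem toTreeClass_injective :
    Function.Injective (toTreeClass : S.Binarization → TreeClass) := fun t t' h => by
  obtain ⟨φ, hφ⟩ := mk_eq_mk.1 h
  rw [← Quotient.out_eq t, ← Quotient.out_eq t']
  exact Quotient.sound ⟨φ, (image_eq_iff_forall_mem φ).2 hφ⟩

theorem range_toTreeClass : Set.range (toTreeClass : S.Binarization → TreeClass) =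
    {q | q.IsBinarization ∧ q.shape = Shape.of S.Vertex} := by
  refine Set.Subset.antisymm (Set.range_subset_iff.2 fun t =>
    ⟨isBinarization_mk.2 (Quotient.out t).2.2.2, Shape.of_eq_of.2 (Quotient.out t).2.2.1⟩) ?_
  rintro q ⟨hq, hshape⟩
  obtain ⟨t, rfl⟩ := q.exists_eq_mk
  have ht : S.IsBinarization t :=
    ⟨top_mem_original hq (hshape ▸ tops_shape_vertex S), Shape.of_eq_of.1 hshape,
      isBinarization_mk.1 hq⟩
  obtain ⟨φ, hφ⟩ := Quotient.mk_out (s := binarizationSetoid S) ⟨t, ht⟩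
  exact ⟨Quotient.mk _ ⟨t, ht⟩, mk_eq_mk.2 ⟨φ, (image_eq_iff_forall_mem φ).1 hφ⟩⟩

end Binarization

theorem symmetryConstant_eq_symmetrySum (S : FinRootedTree) :
    S.symmetryConstant = symmetrySum (Shape.of S.Vertex) := by
  have hfinite : {q : TreeClass | q.IsBinarization ∧ q.shape = Shape.of S.Vertex}.Finite :=
    (finite_setOf_isBinarization (Shape.of S.Vertex).card).subset fun q hq => ⟨hq.1, hq.2 ▸ le_rfl⟩
  have hindicator : restr symmetryWeight (Shape.of S.Vertex) =
      {q : TreeClass | q.IsBinarization ∧ q.shape = Shape.of S.Vertex}.indicator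
        fun q => (1 / 2) ^ q.symmetry := by
    classical
    funext q
    simp only [Set.indicator, restr, symmetryWeight, Set.mem_ofPred_eq]
    split_ifs <;> simp_all
  rw [symmetrySum, total, hindicator, tsum_eq_finsum (hfinite.subset Set.support_indicator_subset),
    ← finsum_mem_def, ← Binarization.range_toTreeClass,
    finsum_mem_range Binarization.toTreeClass_injective]
  rfl

namespace TreeClass

variable {ρ R : ℝ}

theorem IsSingularRadius.hasDominantSingularities_continuedGen (h : IsSingularRadius ρ R) :
    HasDominantSingularities (fun n => Nat.card (NonplaneBinary n)) continuedGen ρ R := by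
  refine ⟨h.pos, h.lt, fun z hz => ?_, h.differentiableOn_continuedGen,
    h.not_exists_analyticAt_continuedGen rfl, h.not_exists_analyticAt_continuedGen (neg_sq _)⟩
  simp only [NonplaneBinary.card_eq_ncard_binaryTrees]
  exact h.continuedGen_eq_gen hz ▸ hasSum_ncard_binaryTrees (h.summable hz 0)

theorem IsContinuation.hasDominantSingularities {S : FinRootedTree} {A : ℂ → ℂ}
    (hA : IsContinuation ρ R (Shape.of S.Vertex) A) (h : IsSingularRadius ρ R) :
    HasDominantSingularities S.totalEmbeddings A ρ R := by
  have hsing {w : ℂ} (hw : w ^ 2 = (ρ : ℂ) ^ 2) :=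
    hA.not_exists_analyticAt h S.shape_vertex_ne_zero (symmetrySum_vertex_pos S) hw
  refine ⟨h.pos, h.lt, fun z hz => ?_, hA.differentiableOn, hsing rfl, hsing (neg_sq _)⟩
  rw [hA.eq_gen z hz, funext S.totalEmbeddings_eq_ncard_binaryTrees]
  exact hasSum_ncard_binaryTrees (h.summable hz _)

end TreeClass

end FinRootedTree

theorem mainTheorem8 :
    ∃ (ρ R : ℝ) (V : ℂ → ℂ),
      |ρ - 0.6346| < 0.00005 ∧
      HasDominantSingularities (fun n => Nat.card (FinRootedTree.NonplaneBinary n)) V ρ R ∧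
      (∀ z : ℂ, ‖z‖ < ρ → V z = z + z / 2 * (V z ^ 2 + V (z ^ 2))) ∧
      ∀ (S : FinRootedTree) (m l u : ℕ),
        m = S.size → l = S.degreeCount 0 → u = S.degreeCount 1 →
        ∃ A : ℂ → ℂ,
          HasDominantSingularities S.totalEmbeddings A ρ R ∧
          ∀ w : ℂ, w = ρ ∨ w = -ρ →
            Asymptotics.IsEquivalent (𝓝[slitDisc ρ R] w) A
              (fun z => (1 / (1 - z * V z)) ^ (m + l - 1) * z ^ (l + u - 1) * V z ^ (l + u) *
                (S.symmetryConstant : ℂ)) := by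
  obtain ⟨ρ, R, h⟩ := FinRootedTree.TreeClass.exists_isSingularRadius
  refine ⟨ρ, R, FinRootedTree.TreeClass.continuedGen, h.abs_sub_lt,
    h.hasDominantSingularities_continuedGen, fun z hz => ?_, ?_⟩
  · rw [h.continuedGen_eq_gen hz, h.continuedGen_eq_gen (h.norm_sq_lt (hz.trans h.lt).le)]
    exact FinRootedTree.TreeClass.gen_zero (h.summable hz 0)
  · rintro S m l u rfl rfl -
    obtain ⟨A, hA⟩ := h.exists_isContinuation S.shape_vertex_ne_zero
    refine ⟨A, hA.hasDominantSingularities h, fun w hw => ?_⟩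
    rw [S.symmetryConstant_eq_symmetrySum]
    exact hA.isEquivalent h S.shape_vertex_ne_zero
      (FinRootedTree.TreeClass.symmetrySum_vertex_pos S) (sq_eq_sq_iff_eq_or_eq_neg.2 hw) u
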